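/- Let $n_T,n_R,K\ge 0$ be integers, $H\in\mathbb{C}^{n_R\times n_T}$ and $N_0>0$. Let $X\sim\mathcal{CN}(0,I_{n_T})$ and $N\sim\mathcal{CN}(0,N_0I_{n_R})$ be independent circularly-symmetric complex Gaussian vectors and let $Y=HX+N$. A channel-shortening receiver of memory $K$ is given by an arbitrary matrix $H_r\in\mathbb{C}^{n_T\times n_R}$ and a Hermitian matrix $G_r\in\mathbb{C}^{n_T\times n_T}$ with $(G_r)_{k\ell}=0$ whenever $|k-\ell|>K$; it uses the mismatched receiver function $$\tilde T(y|x)=\exp\left(2\,\mathrm{Re}\{x^{\mathrm H}H_r y\}-x^{\mathrm H}G_r x\right).$$ Its generalized mutual information (GMI), in nats, is $$I_{\mathrm{GMI}}(H_r,G_r)=-\mathbb{E}\left[\log\tilde T(Y)\right]+\mathbb{E}\left[\log\tilde T(Y|X)\right],\qquad \tilde T(y)=\int\tilde T(y|x)\,p_X(x)\,\mathrm{d}x,$$ where $p_X$ is the density of $X$, and $I_{\mathrm{GMI}}(H_r,G_r)=-\infty$ if the integral $\tilde T(y)$ diverges. Then the maximum of $I_{\mathrm{GMI}}(H_r,G_r)$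 over all such receivers of memory $K$ is attained, and its value, i.e. $I_{\mathrm{GMI}}(H_r^{\mathrm{opt}},G_r^{\mathrm{opt}})$ for every maximizing pair, is $$I_{\mathrm{GMI}}=\sum_{k=1}^{n_T} I(Y;X_k\mid X_{k-1},\ldots,X_{k-K}),$$ where $I(\cdot\,;\cdot\mid\cdot)$ is conditional mutual information in nats and variables $X_j$ with $j<1$ are omitted from the conditioning. -/

import Mathlib

open MeasureTheory ProbabilityTheory
open scoped ENNReal Matrix

noncomputable section

namespace ChannelShortening

/-- The law `CN(0, v I)` of a zero-mean circularly-symmetric complex Gaussian vector of length `n`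
with covariance matrix `v I`, through its density `(π v)⁻ⁿ exp (-‖x‖² / v)` with respect to
Lebesgue measure on `ℂⁿ`. -/
def cscGaussian (n : ℕ) (v : ℝ) : Measure (Fin n → ℂ) :=
  (volume : Measure (Fin n → ℂ)).withDensity fun x =>
    ENNReal.ofReal (((Real.pi * v) ^ n)⁻¹ * Real.exp (-(∑ i, ‖x i‖ ^ 2) / v))

/-- The expectation of an extended-real random variable: expectation of the positive part minus
expectation of the negative part. -/
def expectation {Ω : Type*} [MeasurableSpace Ω] (P : Measure Ω) (f : Ω → EReal) : EReal :=
  ((∫⁻ ω, (f ω).toENNReal ∂P : ℝ≥0∞) : EReal) - ((∫⁻ ω, (-f ω).toENNReal ∂P : ℝ≥0∞) : EReal)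

/-- Conditional mutual information `I(U; V | W)` in nats: the Kullback-Leibler divergence of the
joint law of `(W, (U, V))` from the law `P_W ⊗ (P_{U|W} × P_{V|W})` under which `U` and `V` are
conditionally independent given `W` with the same conditional laws. -/
def condMutualInfo {Ω 𝓤 𝓥 𝓦 : Type*} [MeasurableSpace Ω]
    [MeasurableSpace 𝓤] [StandardBorelSpace 𝓤] [Nonempty 𝓤]
    [MeasurableSpace 𝓥] [StandardBorelSpace 𝓥] [Nonempty 𝓥] [MeasurableSpace 𝓦]
    (P : Measure Ω) [IsFiniteMeasure P] (U : Ω → 𝓤) (V : Ω → 𝓥) (W : Ω → 𝓦) : ℝ≥0∞ :=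
  InformationTheory.klDiv (P.map fun ω => (W ω, (U ω, V ω)))
    ((P.map W) ⊗ₘ ((condDistrib U W P) ×ₖ (condDistrib V W P)))

/-- The mismatched receiver function `exp (2 Re (xᴴ Hr y) - xᴴ Gr x)`
(for Hermitian `Gr` the quadratic form is real). -/
def receiverFn {nT nR : ℕ} (Hr : Matrix (Fin nT) (Fin nR) ℂ) (Gr : Matrix (Fin nT) (Fin nT) ℂ)
    (y : Fin nR → ℂ) (x : Fin nT → ℂ) : ℝ :=
  Real.exp (2 * (star x ⬝ᵥ (Hr *ᵥ y)).re - (star x ⬝ᵥ (Gr *ᵥ x)).re)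

/-- The receiver function averaged over the `CN(0, I)` input law; it is `∞` if the integral
diverges. -/
def receiverOut {nT nR : ℕ} (Hr : Matrix (Fin nT) (Fin nR) ℂ) (Gr : Matrix (Fin nT) (Fin nT) ℂ)
    (y : Fin nR → ℂ) : ℝ≥0∞ :=
  ∫⁻ x, ENNReal.ofReal (receiverFn Hr Gr y x) ∂(cscGaussian nT 1)

/-- The generalized mutual information, in nats, of the receiver with parameters `Hr`, `Gr`, when
`X` is the channel input and `Y` the channel output. It is `-∞` if the receiver function does not
have a finite average over the input law. -/
def gmi {Ω : Type*} [MeasurableSpace Ω] (P : Measure Ω) {nT nR : ℕ}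
    (X : Ω → Fin nT → ℂ) (Y : Ω → Fin nR → ℂ)
    (Hr : Matrix (Fin nT) (Fin nR) ℂ) (Gr : Matrix (Fin nT) (Fin nT) ℂ) : EReal :=
  -(expectation P fun ω => ENNReal.log (receiverOut Hr Gr (Y ω)))
    + expectation P fun ω => ((Real.log (receiverFn Hr Gr (Y ω) (X ω)) : ℝ) : EReal)

/-- `Gr` is an admissible receiver matrix of memory `K`: it is Hermitian and vanishes outside the
center `2K + 1` diagonals. -/
def IsAdmissible {nT : ℕ} (K : ℕ) (Gr : Matrix (Fin nT) (Fin nT) ℂ) : Prop :=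
  Gr.IsHermitian ∧ ∀ i j : Fin nT, (K : ℤ) < |(i : ℤ) - (j : ℤ)| → Gr i j = 0

/-- `(Hr, Gr)` maximizes the generalized mutual information over all receivers of memory `K`. -/
def IsOptimal {Ω : Type*} [MeasurableSpace Ω] (P : Measure Ω) {nT nR : ℕ}
    (X : Ω → Fin nT → ℂ) (Y : Ω → Fin nR → ℂ) (K : ℕ)
    (Hr : Matrix (Fin nT) (Fin nR) ℂ) (Gr : Matrix (Fin nT) (Fin nT) ℂ) : Prop :=
  IsAdmissible K Gr ∧
    ∀ (Hr' : Matrix (Fin nT) (Fin nR) ℂ) (Gr' : Matrix (Fin nT) (Fin nT) ℂ),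
      IsAdmissible K Gr' → gmi P X Y Hr' Gr' ≤ gmi P X Y Hr Gr

/-- The (at most `K`) symbols `X_{k-1}, …, X_{k-K}` preceding `X_k`; symbols with an index before
the first one are absent. -/
def pastSymbols {Ω : Type*} {nT : ℕ} (X : Ω → Fin nT → ℂ) (K : ℕ) (k : Fin nT) :
    Ω → {j : Fin nT // (j : ℕ) < (k : ℕ) ∧ (k : ℕ) ≤ (j : ℕ) + K} → ℂ :=
  fun ω j => X ω j

end ChannelShortening

end

/-! If `1 + Gr` is not positive definite, the averaged receiver function is infinite for every `y`
and the GMI is `-∞` (`receiverOut_eq_top`, `gmi_eq_bot`). Otherwise a Cholesky factorization without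
fill-in gives `Gr = Lᴴ L - 1` with `L` lower triangular of bandwidth `K`, and `Hr = Lᴴ V` with `V`
arbitrary (`exists_factor_of_isAdmissible`). Completing the square, the exponent is `‖V y‖² + ‖x‖² -
‖L x - V y‖²`, so the GMI equals `log |det L|² + E‖X‖² - E‖L X - V Y‖²`.

Since `L` is triangular this splits over rows as `∑ (log |L k k|² + 1 - E|(L X - V Y)_k|²)`. Row `k`
involves only `X_k`, its `K` predecessors and `Y`, hence its error is at least `|L k k|² d_k`, with
`d_k` the linear mean-square error of `X_k` from those observations. From `log u ≤ u - 1` at `u = |L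
k k|² d_k`, each summand is at most `-log d_k`, with equality for the prediction residual scaled to
unit variance. The rows can be chosen independently, so the bound is attained.

It remains that `-log d_k` is the conditional mutual information
(`IsStdGaussian.condMutualInfo_eq`). Every variable is a linear functional of the standard Gaussian
vector `(X, N/√N₀)` and is represented by its coefficient vector: variance is squared norm,
orthogonality is independence, and optimal prediction is orthogonal projection. -/

noncomputable section

namespace ChannelShortening

/-! ### Complex Gaussian laws and their characteristic functions. -/

/-- The law `CN(0, v)` on `ℂ`. -/
def cGaussian (v : ℝ) : Measure ℂ :=
  (volume : Measure ℂ).withDensity fun x =>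
    ENNReal.ofReal ((Real.pi * v)⁻¹ * Real.exp (-‖x‖ ^ 2 / v))

/-- The real dimension of `ℂ` is 2, so `π v` enters to the first power; each real coordinate has
variance `v / 2`, whence the factor `1 / 4`. -/
theorem integral_cexp_mul_gaussian {v : ℝ} (hv : 0 < v) (c : ℂ) :
    ∫ x : ℂ, ((((Real.pi * v)⁻¹ * Real.exp (-‖x‖ ^ 2 / v) : ℝ) : ℂ) *
      Complex.exp ((inner ℝ c x : ℝ) * Complex.I)) = Complex.exp (-(v * ‖c‖ ^ 2 / 4 : ℝ)) := by
  have hb : 0 < (((v⁻¹ : ℝ) : ℂ)).re := by simpa using hv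
  have h := GaussianFourier.integral_cexp_neg_mul_sq_norm_add (V := ℂ) hb Complex.I c
  have h2 : ∀ x : ℂ, ((((Real.pi * v)⁻¹ * Real.exp (-‖x‖ ^ 2 / v) : ℝ) : ℂ) *
      Complex.exp ((inner ℝ c x : ℝ) * Complex.I)) = (((Real.pi * v)⁻¹ : ℝ) : ℂ) *
      Complex.exp (-((v⁻¹ : ℝ) : ℂ) * ‖x‖ ^ 2 + Complex.I * (inner ℝ c x : ℝ)) := by
    intro x
    rw [Complex.exp_add]
    push_cast
    rw [mul_assoc]
    congr 3
    · ring
    · ring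
  simp_rw [h2]
  rw [integral_const_mul, h, Complex.finrank_real_complex]
  have hv' : (v : ℂ) ≠ 0 := by exact_mod_cast hv.ne'
  have hp : (Real.pi : ℂ) ≠ 0 := by exact_mod_cast Real.pi_ne_zero
  have : ((2 : ℕ) : ℂ) / 2 = 1 := by norm_num
  rw [this, Complex.cpow_one]
  push_cast
  rw [← mul_assoc, Complex.I_sq]
  have : ((Real.pi : ℂ) * v)⁻¹ * (Real.pi / (v : ℂ)⁻¹) = 1 := by field_simp
  rw [this, one_mul]
  congr 1
  field_simp

theorem integral_cexp_cGaussian {v : ℝ} (hv : 0 < v) (c : ℂ) :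
    ∫ x, Complex.exp ((inner ℝ c x : ℝ) * Complex.I) ∂(cGaussian v)
      = Complex.exp (-(v * ‖c‖ ^ 2 / 4 : ℝ)) := by
  rw [← integral_cexp_mul_gaussian hv, cGaussian,
    integral_withDensity_eq_integral_toReal_smul (by fun_prop) (by simp)]
  congr 1
  ext x
  rw [ENNReal.toReal_ofReal (by positivity), Complex.real_smul]

theorem integral_cexp_cscGaussian {v : ℝ} (hv : 0 < v) (n : ℕ) (c : Fin n → ℂ) :
    ∫ x, Complex.exp (((∑ i, inner ℝ (c i) (x i) : ℝ)) * Complex.I) ∂(cscGaussian n v)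
      = Complex.exp (-(v * (∑ i, ‖c i‖ ^ 2) / 4 : ℝ)) := by
  rw [cscGaussian, integral_withDensity_eq_integral_toReal_smul (by fun_prop) (by simp)]
  have h : ∀ x : Fin n → ℂ, (ENNReal.ofReal (((Real.pi * v) ^ n)⁻¹ *
      Real.exp (-(∑ i, ‖x i‖ ^ 2) / v))).toReal •
        Complex.exp (((∑ i, inner ℝ (c i) (x i) : ℝ)) * Complex.I) =
      ∏ i, ((((Real.pi * v)⁻¹ * Real.exp (-‖x i‖ ^ 2 / v) : ℝ) : ℂ) *
      Complex.exp ((inner ℝ (c i) (x i) : ℝ) * Complex.I)) := by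
    intro x
    rw [ENNReal.toReal_ofReal (by positivity), Complex.real_smul, Finset.prod_mul_distrib,
      ← Complex.exp_sum, ← Complex.ofReal_prod, Finset.prod_mul_distrib, ← Real.exp_sum,
      Finset.prod_const, Finset.card_univ, Fintype.card_fin, inv_pow, Complex.ofReal_sum,
      Finset.sum_mul, ← Finset.sum_div, Finset.sum_neg_distrib]
  simp_rw [h]
  rw [integral_fintype_prod_volume_eq_prod (𝕜 := ℂ) (fun i (x : ℂ) =>
      ((((Real.pi * v)⁻¹ * Real.exp (-‖x‖ ^ 2 / v) : ℝ) : ℂ) *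
      Complex.exp ((inner ℝ (c i) x : ℝ) * Complex.I)))]
  simp_rw [integral_cexp_mul_gaussian hv]
  rw [← Complex.exp_sum]
  congr 1
  push_cast
  rw [Finset.sum_neg_distrib, Finset.mul_sum, Finset.sum_div]

/-- Used to read the total mass off the characteristic function at `c = 0`. -/
theorem isProbabilityMeasure_of_integral_one {α : Type*} [MeasurableSpace α] {μ : Measure α}
    (h : ∫ _, (1 : ℂ) ∂μ = 1) : IsProbabilityMeasure μ := by
  rw [integral_const, Complex.real_smul, mul_one] at h
  have h' : μ.real Set.univ = 1 := by exact_mod_cast h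
  exact ⟨by simpa [measureReal_def, ENNReal.toReal_eq_one_iff] using h'⟩

theorem isProbabilityMeasure_cGaussian {v : ℝ} (hv : 0 < v) :
    IsProbabilityMeasure (cGaussian v) :=
  isProbabilityMeasure_of_integral_one (by simpa using integral_cexp_cGaussian hv 0)

theorem isProbabilityMeasure_cscGaussian {v : ℝ} (hv : 0 < v) (n : ℕ) :
    IsProbabilityMeasure (cscGaussian n v) :=
  isProbabilityMeasure_of_integral_one (by simpa using integral_cexp_cscGaussian hv n 0)

/-! ### Linear functionals of a standard complex Gaussian vector. -/

section StdGaussian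

variable {Ω ι : Type*} [MeasurableSpace Ω] [Fintype ι] {P : Measure Ω}

/-- `S` is a standard circularly-symmetric complex Gaussian vector, in terms of its
characteristic function. -/
structure IsStdGaussian (S : Ω → EuclideanSpace ℂ ι) (P : Measure Ω) : Prop where
  aemeasurable : AEMeasurable S P
  integral_cexp : ∀ c, ∫ ω, Complex.exp ((inner ℂ c (S ω)).re * Complex.I) ∂P
    = Complex.exp (-(‖c‖ ^ 2 / 4 : ℝ))

namespace IsStdGaussian

variable {S : Ω → EuclideanSpace ℂ ι}

theorem aemeasurable_inner (hS : IsStdGaussian S P) (c : EuclideanSpace ℂ ι) :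
    AEMeasurable (fun ω => inner ℂ c (S ω)) P := by
  have : Measurable fun x : EuclideanSpace ℂ ι => inner ℂ c x :=
    (continuous_const.inner continuous_id).measurable
  exact this.comp_aemeasurable hS.aemeasurable

/-- Real multiples of `c` in the defining identity give the whole one-dimensional characteristic
function. -/
theorem map_re_inner [IsProbabilityMeasure P] (hS : IsStdGaussian S P)
    (c : EuclideanSpace ℂ ι) :
    P.map (fun ω => (inner ℂ c (S ω)).re) = gaussianReal 0 (‖c‖₊ ^ 2 / 2) := by
  have hm : AEMeasurable (fun ω => (inner ℂ c (S ω)).re) P :=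
    Complex.measurable_re.comp_aemeasurable (hS.aemeasurable_inner c)
  have := Measure.isProbabilityMeasure_map hm
  apply Measure.ext_of_charFun
  ext t
  rw [charFun_apply_real, integral_map hm (by fun_prop), charFun_gaussianReal]
  have h := hS.integral_cexp ((t : ℂ) • c)
  have h1 : ∀ ω, (inner ℂ ((t : ℂ) • c) (S ω)).re = t * (inner ℂ c (S ω)).re := by
    intro ω
    rw [inner_smul_left, Complex.conj_ofReal, Complex.re_ofReal_mul]
  simp_rw [h1] at h
  push_cast at h
  rw [h]
  congr 1
  have h2 : ‖(t : ℂ) • c‖ ^ 2 = t ^ 2 * ‖c‖ ^ 2 := by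
    rw [norm_smul, Complex.norm_real, mul_pow, Real.norm_eq_abs, sq_abs]
  have h3 : ((‖(t : ℂ) • c‖ : ℝ) : ℂ) ^ 2 = t ^ 2 * ‖c‖ ^ 2 := by exact_mod_cast h2
  rw [h3]
  simp
  ring

theorem integrable_re_inner_sq [IsProbabilityMeasure P] (hS : IsStdGaussian S P)
    (c : EuclideanSpace ℂ ι) :
    Integrable (fun ω => (inner ℂ c (S ω)).re ^ 2) P ∧
      ∫ ω, (inner ℂ c (S ω)).re ^ 2 ∂P = ‖c‖ ^ 2 / 2 := by
  have hm : AEMeasurable (fun ω => (inner ℂ c (S ω)).re) P :=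
    Complex.measurable_re.comp_aemeasurable (hS.aemeasurable_inner c)
  have hmap := hS.map_re_inner c
  have hL : MemLp (fun x : ℝ => x) 2 (gaussianReal 0 (‖c‖₊ ^ 2 / 2)) := memLp_id_gaussianReal 2
  have hi := hL.integrable_sq
  have hvar := variance_id_gaussianReal (μ := 0) (v := ‖c‖₊ ^ 2 / 2)
  rw [variance_of_integral_eq_zero aemeasurable_id (by simp)] at hvar
  constructor
  · rw [← hmap] at hi
    exact hi.comp_aemeasurable hm
  · rw [← hmap, integral_map hm (by fun_prop)] at hvar
    simpa using hvar

/-- The imaginary part of `⟪c, S⟫` is the real part of `⟪i c, S⟫`, so both halves follow from the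
real case. -/
theorem integrable_norm_inner_sq [IsProbabilityMeasure P] (hS : IsStdGaussian S P)
    (c : EuclideanSpace ℂ ι) :
    Integrable (fun ω => ‖inner ℂ c (S ω)‖ ^ 2) P ∧
      ∫ ω, ‖inner ℂ c (S ω)‖ ^ 2 ∂P = ‖c‖ ^ 2 := by
  obtain ⟨h1, h2⟩ := hS.integrable_re_inner_sq c
  obtain ⟨h3, h4⟩ := hS.integrable_re_inner_sq (Complex.I • c)
  have h5 : ∀ ω, ‖inner ℂ c (S ω)‖ ^ 2 =
      (inner ℂ c (S ω)).re ^ 2 + (inner ℂ (Complex.I • c) (S ω)).re ^ 2 := by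
    intro ω
    rw [← Complex.normSq_eq_norm_sq, Complex.normSq_apply, inner_smul_left]
    simp
    ring
  simp_rw [h5]
  refine ⟨h1.add h3, ?_⟩
  rw [integral_add h1 h3, h2, h4, norm_smul, Complex.norm_I]
  ring

theorem map_inner [IsProbabilityMeasure P] (hS : IsStdGaussian S P)
    {c : EuclideanSpace ℂ ι} (hc : c ≠ 0) :
    P.map (fun ω => inner ℂ c (S ω)) = cGaussian (‖c‖ ^ 2) := by
  have hm := hS.aemeasurable_inner c
  have hpos : 0 < ‖c‖ ^ 2 := by positivity
  have := Measure.isProbabilityMeasure_map hm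
  have := isProbabilityMeasure_cGaussian hpos
  apply Measure.ext_of_charFun
  ext t
  rw [charFun_apply, charFun_apply, integral_map hm (by fun_prop)]
  simp_rw [real_inner_comm]
  rw [integral_cexp_cGaussian hpos]
  have h := hS.integral_cexp (t • c)
  have h1 : ∀ ω, (inner ℂ (t • c) (S ω)).re = inner ℝ t (inner ℂ c (S ω)) := by
    intro ω
    rw [inner_smul_left, Complex.inner, mul_comm]
  simp_rw [h1] at h
  rw [h, norm_smul]
  congr 3
  ring

/-- A real-linear functional on `ℂ` is `x ↦ Re (conj a x)`. -/
theorem exists_conj_of_real_functional (L : ℂ →L[ℝ] ℝ) :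
    ∃ a : ℂ, ∀ x, L x = ((starRingEnd ℂ) a * x).re := by
  refine ⟨(InnerProductSpace.toDual ℝ ℂ).symm L, fun x => ?_⟩
  rw [mul_comm, ← Complex.inner, InnerProductSpace.toDual_symm_apply]

theorem integral_cexp_re [IsProbabilityMeasure P] (hS : IsStdGaussian S P)
    {f : Ω → ℝ} (c : EuclideanSpace ℂ ι) (hf : ∀ ω, f ω = (inner ℂ c (S ω)).re) :
    ∫ ω, Complex.exp (f ω * Complex.I) ∂P = Complex.exp (-(‖c‖ ^ 2 / 4 : ℝ)) := by
  simp_rw [hf]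
  exact hS.integral_cexp c

/-- A real functional of the pair is again `Re ⟪·, S⟫`, with coefficient vector a combination of `c`
plus one of the `b j`. Complex orthogonality makes Pythagoras apply to every such sum, so the joint
characteristic function factors. -/
theorem indepFun_inner [IsProbabilityMeasure P] (hS : IsStdGaussian S P) {κ : Type*} [Fintype κ]
    (c : EuclideanSpace ℂ ι) (b : κ → EuclideanSpace ℂ ι) (h : ∀ j, inner ℂ (b j) c = 0) :
    IndepFun (fun ω => inner ℂ c (S ω)) (fun ω j => inner ℂ (b j) (S ω)) P := by
  classical
  have hm := hS.aemeasurable_inner c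
  have hm' : AEMeasurable (fun ω j => inner ℂ (b j) (S ω)) P :=
    aemeasurable_pi_iff.2 fun j => hS.aemeasurable_inner (b j)
  rw [indepFun_iff_charFunDual_prod hm hm']
  intro L
  obtain ⟨a, ha⟩ := exists_conj_of_real_functional (L.comp (.inl ℝ ℂ (κ → ℂ)))
  choose d hd using fun j => exists_conj_of_real_functional
    ((L.comp (.inr ℝ ℂ (κ → ℂ))).comp (.single ℝ (fun _ : κ => ℂ) j))
  have hL2 : ∀ z, L.comp (.inr ℝ ℂ (κ → ℂ)) z = ∑ j, ((starRingEnd ℂ) (d j) * z j).re := by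
    intro z
    conv_lhs => rw [← Finset.univ_sum_single z, map_sum]
    exact Finset.sum_congr rfl fun j _ => hd j (z j)
  have hL : ∀ x z, L (x, z) = L.comp (.inl ℝ ℂ (κ → ℂ)) x + L.comp (.inr ℝ ℂ (κ → ℂ)) z := by
    intro x z
    simp [← map_add]
  have hB : ∀ ω, L.comp (.inr ℝ ℂ (κ → ℂ)) (fun j => inner ℂ (b j) (S ω)) =
      (inner ℂ (∑ j, d j • b j) (S ω)).re := by
    intro ω
    rw [hL2, sum_inner, Complex.re_sum]
    simp_rw [inner_smul_left]
  have hA : ∀ ω, L.comp (.inl ℝ ℂ (κ → ℂ)) (inner ℂ c (S ω)) = (inner ℂ (a • c) (S ω)).re := by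
    intro ω
    rw [ha, inner_smul_left]
  have hAB : ∀ ω, L (inner ℂ c (S ω), fun j => inner ℂ (b j) (S ω)) =
      (inner ℂ (a • c + ∑ j, d j • b j) (S ω)).re := by
    intro ω
    rw [hL, hA, hB, inner_add_left, Complex.add_re]
  have ho : inner ℂ (a • c) (∑ j, d j • b j) = 0 := by
    rw [inner_smul_left, inner_sum]
    simp_rw [inner_smul_right]
    have : ∀ j, inner ℂ c (b j) = 0 := fun j => inner_eq_zero_symm.1 (h j)
    simp [this]
  rw [charFunDual_apply, charFunDual_apply, charFunDual_apply,
    integral_map (hm.prodMk hm') (by fun_prop), integral_map hm (by fun_prop),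
    integral_map hm' (by fun_prop), hS.integral_cexp_re _ hAB, hS.integral_cexp_re _ hA,
    hS.integral_cexp_re _ hB, ← Complex.exp_add]
  have hn := norm_add_sq_eq_norm_sq_add_norm_sq_of_inner_eq_zero _ _ ho
  congr 1
  rw [pow_two ‖a • c + _‖, hn]
  push_cast
  ring

end IsStdGaussian

end StdGaussian

/-! ### Banded triangular matrices and Cholesky factorization without fill-in. -/

/-- `L` is lower triangular and vanishes below its first `K` subdiagonals. -/
def IsLowerBanded {n : ℕ} (K : ℕ) (L : Matrix (Fin n) (Fin n) ℂ) : Prop :=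
  ∀ k j, L k j ≠ 0 → (j : ℕ) ≤ k ∧ (k : ℕ) ≤ j + K

theorem IsLowerBanded.det {n K : ℕ} {L : Matrix (Fin n) (Fin n) ℂ} (hL : IsLowerBanded K L) :
    L.det = ∏ k, L k k := by
  apply Matrix.det_of_isLowerTriangular
  intro i j hij
  by_contra h
  have := (hL i j h).1
  have : i < j := hij
  omega

/-- A nonzero off-diagonal entry `(i, j)` of `Lᴴ L` needs a row `k` with both `i` and `j` in `[k -
K, k]`. -/
theorem IsLowerBanded.isAdmissible {n K : ℕ} {L : Matrix (Fin n) (Fin n) ℂ}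
    (hL : IsLowerBanded K L) : IsAdmissible K (Lᴴ * L - 1) := by
  refine ⟨(Matrix.isHermitian_conjTranspose_mul_self L).sub Matrix.isHermitian_one, ?_⟩
  intro i j hij
  have hne : i ≠ j := by
    rintro rfl
    simp at hij
    omega
  rw [Matrix.sub_apply, Matrix.one_apply_ne hne, sub_zero, Matrix.mul_apply]
  refine Finset.sum_eq_zero fun k _ => ?_
  by_contra h
  have h1 : L k j ≠ 0 := right_ne_zero_of_mul h
  have h2 : L k i ≠ 0 := by
    have := left_ne_zero_of_mul h
    rw [Matrix.conjTranspose_apply] at this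
    exact star_ne_zero.1 this
  have := hL _ _ h1
  have := hL _ _ h2
  rcases abs_cases ((i : ℤ) - j) with h | h <;> omega

section Cholesky

open scoped ComplexOrder

/-- The form of the Schur complement at `x` is the form of `F` at `x` extended by a suitable last
coordinate. -/
theorem schurComplement_last_posDef {n : ℕ} {F : Matrix (Fin (n + 1)) (Fin (n + 1)) ℂ}
    (hF : F.PosDef) :
    (Matrix.of fun i j : Fin n => F i.castSucc j.castSucc -
      F i.castSucc (Fin.last n) * F (Fin.last n) j.castSucc /
        F (Fin.last n) (Fin.last n)).PosDef := by
  have hH : ∀ i j, star (F i j) = F j i := fun i j => hF.isHermitian.apply j i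
  have ha : F (Fin.last n) (Fin.last n) ≠ 0 := (hF.diag_pos (i := Fin.last n)).ne'
  apply Matrix.PosDef.of_dotProduct_mulVec_pos
  · ext i j
    simp only [Matrix.conjTranspose_apply, Matrix.of_apply, star_sub, star_div₀, star_mul', hH]
    ring
  · intro x hx
    set a := F (Fin.last n) (Fin.last n) with hadef
    set b := ∑ j : Fin n, F (Fin.last n) j.castSucc * x j with hb
    set b' := ∑ i : Fin n, star (x i) * F i.castSucc (Fin.last n) with hb'
    -- The last coordinate `-b / a` is the one that annihilates the last entry of `F` times the
    -- extended vector.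
    have hx' : (Fin.snoc x (-b / a) : Fin (n + 1) → ℂ) ≠ 0 := by
      intro h
      apply hx
      ext j
      have := congrFun h j.castSucc
      simpa using this
    have h := hF.dotProduct_mulVec_pos hx'
    have hsa : star a = a := hH _ _
    convert h using 1
    have e1 : ∀ i : Fin n, (F *ᵥ (Fin.snoc x (-b / a) : Fin (n + 1) → ℂ)) i.castSucc =
        ∑ j : Fin n, F i.castSucc j.castSucc * x j + F i.castSucc (Fin.last n) * (-b / a) := by
      intro i
      simp [Matrix.mulVec, dotProduct, Fin.sum_univ_castSucc]
    have e2 : (F *ᵥ (Fin.snoc x (-b / a) : Fin (n + 1) → ℂ)) (Fin.last n) = 0 := by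
      simp only [Matrix.mulVec, dotProduct, Fin.sum_univ_castSucc, Fin.snoc_castSucc,
        Fin.snoc_last, ← hb, ← hadef]
      field_simp
      ring
    rw [dotProduct, dotProduct, Fin.sum_univ_castSucc, e2, mul_zero, add_zero]
    simp_rw [e1]
    simp only [Pi.star_apply, Fin.snoc_castSucc, Matrix.mulVec, dotProduct, Matrix.of_apply]
    refine Finset.sum_congr rfl fun i _ => ?_
    congr 1
    rw [hb, neg_div, Finset.sum_div, mul_neg, ← sub_eq_add_neg, Finset.mul_sum,
      ← Finset.sum_sub_distrib]
    refine Finset.sum_congr rfl fun j _ => ?_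
    ring

/-- In `Lᴴ L` with `L` lower triangular, elimination starts from the last index: the last row of `L`
is that of `F` divided by the root of the corner entry, and the rest factors the Schur complement.
-/
theorem exists_banded_cholesky (K : ℕ) : ∀ {n : ℕ} {F : Matrix (Fin n) (Fin n) ℂ}, F.PosDef →
    (∀ i j : Fin n, (K : ℤ) < |(i : ℤ) - (j : ℤ)| → F i j = 0) →
    ∃ L : Matrix (Fin n) (Fin n) ℂ, Lᴴ * L = F ∧ IsLowerBanded K L ∧ ∀ k, L k k ≠ 0 := by
  intro n
  induction n with
  | zero =>
    intro F _ _
    exact ⟨F, Subsingleton.elim _ _, fun k => k.elim0, fun k => k.elim0⟩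
  | succ n ih =>
    intro F hF hband
    have hH : ∀ i j, star (F i j) = F j i := fun i j => hF.isHermitian.apply j i
    have ha := hF.diag_pos (i := Fin.last n)
    obtain ⟨L', hL', hb', hd'⟩ := ih (schurComplement_last_posDef hF) (by
      intro i j hij
      have h1 : F i.castSucc j.castSucc = 0 := hband _ _ (by simpa using hij)
      -- No fill-in: the correction is nonzero only if `i` and `j` are both within `K` of the last
      -- index, hence within `K` of each other.
      have h2 : F i.castSucc (Fin.last n) * F (Fin.last n) j.castSucc = 0 := by
        by_cases h : (i : ℤ) ≤ j
        · rw [hband i.castSucc (Fin.last n), zero_mul]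
          rw [abs_of_nonpos (by omega)] at hij
          simp only [Fin.val_castSucc, Fin.val_last]
          rw [abs_of_nonpos (by omega)]
          omega
        · rw [hband (Fin.last n) j.castSucc, mul_zero]
          rw [abs_of_nonneg (by omega)] at hij
          simp only [Fin.val_castSucc, Fin.val_last]
          rw [abs_of_nonneg (by omega)]
          omega
      simp [h1, h2])
    set a := F (Fin.last n) (Fin.last n) with hadef
    obtain ⟨r, hr⟩ : ∃ r : ℝ, a = r := ⟨a.re, by
      rw [Complex.pos_iff] at ha
      exact Complex.ext rfl (by simpa using ha.2.symm)⟩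
    have hr0 : 0 < r := by rw [hr] at ha; exact_mod_cast ha
    have hs0 : ((√r : ℝ) : ℂ) ≠ 0 := by exact_mod_cast (Real.sqrt_pos.2 hr0).ne'
    have hss : ((√r : ℝ) : ℂ) * ((√r : ℝ) : ℂ) = a := by
      rw [hr, ← Complex.ofReal_mul, Real.mul_self_sqrt hr0.le]
    have hL'' : ∀ i j, ∑ k, star (L' k i) * L' k j = F i.castSucc j.castSucc -
      F i.castSucc (Fin.last n) * F (Fin.last n) j.castSucc / a := by
      intro i j
      have := congrFun (congrFun hL' i) j
      simpa [Matrix.mul_apply] using this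
    let L : Matrix (Fin (n + 1)) (Fin (n + 1)) ℂ := Matrix.of
      (Fin.snoc (fun k : Fin n => Fin.snoc (L' k) 0) fun j => F (Fin.last n) j / (√r : ℝ))
    have l1 : ∀ k j, L (Fin.castSucc k) (Fin.castSucc j) = L' k j := by simp [L]
    have l2 : ∀ k, L (Fin.castSucc k) (Fin.last n) = 0 := by simp [L]
    have l3 : ∀ j, L (Fin.last n) j = F (Fin.last n) j / (√r : ℝ) := by simp [L]
    have hst : star ((√r : ℝ) : ℂ) = (√r : ℝ) := Complex.conj_ofReal _
    have ha0 : a ≠ 0 := ha.ne'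
    refine ⟨L, ?_, ?_, ?_⟩
    · ext i j
      rw [Matrix.mul_apply, Fin.sum_univ_castSucc]
      simp only [Matrix.conjTranspose_apply, l3, star_div₀, hH, hst]
      rw [div_mul_div_comm, hss]
      induction i using Fin.lastCases with
      | last =>
        simp only [l2, star_zero, zero_mul, Finset.sum_const_zero, zero_add, ← hadef]
        field_simp
      | cast i =>
        induction j using Fin.lastCases with
        | last =>
          simp only [l2, mul_zero, Finset.sum_const_zero, zero_add, ← hadef]
          field_simp
        | cast j =>
          simp only [l1, hL'']
          ring
    · intro k j hkj
      induction k using Fin.lastCases with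
      | last =>
        rw [l3] at hkj
        refine ⟨by simpa using Fin.is_le j, ?_⟩
        by_contra h
        apply hkj
        rw [hband, zero_div]
        simp only [Fin.val_last] at h ⊢
        rw [abs_of_nonneg (by omega)]
        omega
      | cast k =>
        induction j using Fin.lastCases with
        | last => exact absurd (l2 k) hkj
        | cast j =>
          rw [l1] at hkj
          simpa using hb' k j hkj
    · intro k
      induction k using Fin.lastCases with
      | last => rw [l3]; exact div_ne_zero ha0 hs0
      | cast k => rw [l1]; exact hd' k

end Cholesky

/-! ### Least-squares residuals in an inner product space. -/

/-- The orthogonal residual of a vector with respect to a finite family. -/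
theorem exists_residual {E κ : Type*} [NormedAddCommGroup E] [InnerProductSpace ℂ E] [Fintype κ]
    (e : E) (b : κ → E) :
    ∃ a : κ → ℂ, ∀ j, inner ℂ (b j) (e - ∑ i, a i • b i) = 0 := by
  let M := Submodule.span ℂ (Set.range b)
  have : FiniteDimensional ℂ M := FiniteDimensional.span_of_finite ℂ (Set.finite_range b)
  obtain ⟨a, ha⟩ := (Submodule.mem_span_range_iff_exists_fun ℂ).1
    (M.starProjection_apply_mem e)
  refine ⟨a, fun j => ?_⟩
  rw [ha]
  exact M.mem_orthogonal _ |>.1 (M.sub_starProjection_mem_orthogonal e) _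
    (Submodule.subset_span ⟨j, rfl⟩)

/-- Among all `e - ∑ cᵢ bᵢ`, the residual orthogonal to the family `b` has the least norm. -/
theorem norm_residual_le {E κ : Type*} [NormedAddCommGroup E] [InnerProductSpace ℂ E] [Fintype κ]
    {e : E} {b : κ → E} {a : κ → ℂ} (h : ∀ j, inner ℂ (b j) (e - ∑ i, a i • b i) = 0)
    (c : κ → ℂ) : ‖e - ∑ i, a i • b i‖ ≤ ‖e - ∑ i, c i • b i‖ := by
  have h1 : e - ∑ i, c i • b i = (∑ i, (a i - c i) • b i) + (e - ∑ i, a i • b i) := by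
    simp_rw [sub_smul, Finset.sum_sub_distrib]
    abel
  have h2 : inner ℂ (∑ i, (a i - c i) • b i) (e - ∑ i, a i • b i) = 0 := by
    rw [sum_inner]
    simp_rw [inner_smul_left, h, mul_zero, Finset.sum_const_zero]
  have h3 := norm_add_sq_eq_norm_sq_add_norm_sq_of_inner_eq_zero _ _ h2
  rw [← h1] at h3
  nlinarith [norm_nonneg (e - ∑ i, c i • b i), norm_nonneg (e - ∑ i, a i • b i),
    mul_self_nonneg ‖∑ i, (a i - c i) • b i‖]

theorem norm_mul_norm_residual_le {E κ : Type*} [NormedAddCommGroup E] [InnerProductSpace ℂ E]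
    [Fintype κ] {e : E} {b : κ → E} {a : κ → ℂ}
    (h : ∀ j, inner ℂ (b j) (e - ∑ i, a i • b i) = 0) {t : ℂ} (ht : t ≠ 0) (c : κ → ℂ) :
    ‖t‖ * ‖e - ∑ i, a i • b i‖ ≤ ‖t • e - ∑ i, c i • b i‖ := by
  have h1 : t • e - ∑ i, c i • b i = t • (e - ∑ i, (t⁻¹ * c i) • b i) := by
    rw [smul_sub, Finset.smul_sum]
    simp_rw [smul_smul, mul_inv_cancel_left₀ ht]
  rw [h1, norm_smul]
  exact mul_le_mul_of_nonneg_left (norm_residual_le h _) (norm_nonneg t)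

/-! ### Conditional mutual information from a Gaussian prediction residual. -/

section KL

/-- The density of `CN(a, d)` with respect to `CN(0, 1)`. -/
def gaussianRatio (d : ℝ) (a x : ℂ) : ℝ := d⁻¹ * Real.exp (‖x‖ ^ 2 - ‖x - a‖ ^ 2 / d)

theorem measurable_gaussianRatio (d : ℝ) {α : Type*} [MeasurableSpace α] {f g : α → ℂ}
    (hf : Measurable f) (hg : Measurable g) : Measurable fun p => gaussianRatio d (f p) (g p) := by
  unfold gaussianRatio
  fun_prop

theorem gaussianRatio_pos {d : ℝ} (hd : 0 < d) (a x : ℂ) : 0 < gaussianRatio d a x := by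
  unfold gaussianRatio
  positivity

theorem log_gaussianRatio {d : ℝ} (hd : 0 < d) (a x : ℂ) :
    Real.log (gaussianRatio d a x) = -Real.log d + (‖x‖ ^ 2 - ‖x - a‖ ^ 2 / d) := by
  rw [gaussianRatio, Real.log_mul (by positivity) (Real.exp_ne_zero _), Real.log_exp,
    Real.log_inv]

theorem lintegral_cGaussian (v : ℝ) {G : ℂ → ℝ≥0∞} (hG : Measurable G) :
    ∫⁻ x, G x ∂(cGaussian v) =
      ∫⁻ x, ENNReal.ofReal ((Real.pi * v)⁻¹ * Real.exp (-‖x‖ ^ 2 / v)) * G x := by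
  have hm : Measurable fun x : ℂ =>
      ENNReal.ofReal ((Real.pi * v)⁻¹ * Real.exp (-‖x‖ ^ 2 / v)) := by fun_prop
  exact lintegral_withDensity_eq_lintegral_mul _ hm hG

theorem lintegral_cGaussian_add (d : ℝ) (a : ℂ) {G : ℂ → ℝ≥0∞} (hG : Measurable G) :
    ∫⁻ e, G (e + a) ∂(cGaussian d) =
      ∫⁻ x, ENNReal.ofReal (gaussianRatio d a x) * G x ∂(cGaussian 1) := by
  have hm : Measurable fun x => gaussianRatio d a x :=
    measurable_gaussianRatio d measurable_const measurable_id
  have h1 := lintegral_cGaussian d (G := fun e => G (e + a)) (hG.comp (measurable_add_const a))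
  have h2 := lintegral_cGaussian 1 (hm.ennreal_ofReal.mul hG)
  have h3 := lintegral_sub_right_eq_self (μ := (volume : Measure ℂ)) (fun x =>
    ENNReal.ofReal ((Real.pi * d)⁻¹ * Real.exp (-‖x‖ ^ 2 / d)) * G (x + a)) a
  refine h1.trans (h3.symm.trans (Eq.trans ?_ h2.symm))
  refine lintegral_congr fun x => ?_
  simp only [Pi.mul_apply, sub_add_cancel]
  rw [← mul_assoc, ← ENNReal.ofReal_mul (by positivity)]
  congr 2
  rw [gaussianRatio, mul_one, div_one, mul_mul_mul_comm, ← Real.exp_add, ← mul_inv]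
  congr 2
  ring

attribute [local irreducible] gaussianRatio

/-- The Kullback-Leibler divergence in terms of a positive density. -/
theorem klDiv_withDensity_ofReal {α : Type*} [MeasurableSpace α] {μ ν : Measure α}
    [IsProbabilityMeasure μ] [IsProbabilityMeasure ν] {g : α → ℝ} (hg : Measurable g)
    (hpos : ∀ x, 0 < g x) (hμ : μ = ν.withDensity fun x => ENNReal.ofReal (g x))
    (hi : Integrable (fun x => Real.log (g x)) μ) :
    InformationTheory.klDiv μ ν = ENNReal.ofReal (∫ x, Real.log (g x) ∂μ) ∧
      0 ≤ ∫ x, Real.log (g x) ∂μ := by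
  have hac : μ ≪ ν := hμ ▸ withDensity_absolutelyContinuous _ _
  have hllr : llr μ ν =ᵐ[μ] fun x => Real.log (g x) := by
    have h := Measure.rnDeriv_withDensity ν hg.ennreal_ofReal
    rw [← hμ] at h
    filter_upwards [hac.ae_le h] with x hx
    rw [llr, hx, ENNReal.toReal_ofReal (hpos x).le]
  rw [← integral_congr_ae hllr,
    ← InformationTheory.toReal_klDiv_of_measure_eq hac (by simp),
    ENNReal.ofReal_toReal (InformationTheory.klDiv_ne_top hac ((integrable_congr hllr).2 hi))]
  exact ⟨rfl, ENNReal.toReal_nonneg⟩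

variable {Ω 𝓤 𝓦 : Type*} [MeasurableSpace Ω] [MeasurableSpace 𝓤] [StandardBorelSpace 𝓤]
  [Nonempty 𝓤] [MeasurableSpace 𝓦] {P : Measure Ω} [IsProbabilityMeasure P]
  {U : Ω → 𝓤} {V : Ω → ℂ} {W : Ω → 𝓦} {φ : 𝓦 × 𝓤 → ℂ} {d : ℝ}

/-- Given `(W, U)`, the variable `V = φ (W, U) + E` has law `CN(φ (W, U), d)`. Under the reference
measure it has law `CN(0, 1)`, because `V` is independent of `W`. The density is the ratio of the
two. -/
theorem map_eq_withDensity_compProd (hU : AEMeasurable U P) (hV : AEMeasurable V P)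
    (hW : AEMeasurable W P) (hVW : IndepFun W V P) (hV1 : P.map V = cGaussian 1)
    (hφ : Measurable φ) (hd : 0 < d)
    (hE : P.map (fun ω => V ω - φ (W ω, U ω)) = cGaussian d)
    (hind : IndepFun (fun ω => (W ω, U ω)) (fun ω => V ω - φ (W ω, U ω)) P) :
    P.map (fun ω => (W ω, (U ω, V ω))) =
      ((P.map W) ⊗ₘ ((condDistrib U W P) ×ₖ (condDistrib V W P))).withDensity
        fun p => ENNReal.ofReal (gaussianRatio d (φ (p.1, p.2.1)) p.2.2) := by
  have hZ : AEMeasurable (fun ω => (W ω, U ω)) P := hW.prodMk hU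
  have hEm : AEMeasurable (fun ω => V ω - φ (W ω, U ω)) P := hV.sub (hφ.comp_aemeasurable hZ)
  have := isProbabilityMeasure_cGaussian hd
  have := isProbabilityMeasure_cGaussian one_pos
  have := Measure.isProbabilityMeasure_map hW
  have hf : Measurable fun p : 𝓦 × 𝓤 × ℂ =>
      ENNReal.ofReal (gaussianRatio d (φ (p.1, p.2.1)) p.2.2) :=
    (measurable_gaussianRatio d (by fun_prop) (by fun_prop)).ennreal_ofReal
  have hcond : condDistrib V W P =ᵐ[P.map W] Kernel.const 𝓦 (cGaussian 1) := by
    apply condDistrib_ae_eq_of_measure_eq_compProd W hV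
    rw [Measure.compProd_const, ← hV1]
    exact (indepFun_iff_map_prod_eq_prod_map_map hW hV).1 hVW
  refine Measure.ext_of_lintegral _ fun F hF => ?_
  have hG : Measurable fun p : 𝓦 × 𝓤 × ℂ =>
      ENNReal.ofReal (gaussianRatio d (φ (p.1, p.2.1)) p.2.2) * F p := hf.mul hF
  rw [lintegral_withDensity_eq_lintegral_mul _ hf hF]
  simp only [Pi.mul_apply]
  rw [Measure.lintegral_compProd hG, lintegral_map' hF.aemeasurable (hW.prodMk (hU.prodMk hV))]
  have h1 : ∫⁻ w, ∫⁻ p, ENNReal.ofReal (gaussianRatio d (φ (w, p.1)) p.2) * F (w, p)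
        ∂((condDistrib U W P) ×ₖ (condDistrib V W P)) w ∂(P.map W) =
      ∫⁻ w, ∫⁻ u, ∫⁻ x, ENNReal.ofReal (gaussianRatio d (φ (w, u)) x) * F (w, (u, x))
        ∂(cGaussian 1) ∂(condDistrib U W P w) ∂(P.map W) := by
    apply lintegral_congr_ae
    filter_upwards [hcond] with w hw
    have hm : Measurable fun p : 𝓤 × ℂ =>
        ENNReal.ofReal (gaussianRatio d (φ (w, p.1)) p.2) * F (w, p) := by
      exact hG.comp (measurable_prodMk_left (x := w))
    rw [Kernel.prod_apply, hw, Kernel.const_apply, lintegral_prod _ hm.aemeasurable]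
  have h2 : Measurable fun z : 𝓦 × 𝓤 => ∫⁻ x, ENNReal.ofReal (gaussianRatio d (φ z) x) *
      F (z.1, (z.2, x)) ∂(cGaussian 1) := by
    have : Measurable fun q : (𝓦 × 𝓤) × ℂ =>
        ENNReal.ofReal (gaussianRatio d (φ q.1) q.2) * F (q.1.1, (q.1.2, q.2)) :=
      hG.comp (by fun_prop : Measurable fun q : (𝓦 × 𝓤) × ℂ => (q.1.1, (q.1.2, q.2)))
    exact this.lintegral_prod_right'
  refine Eq.trans ?_ h1.symm
  rw [← Measure.lintegral_compProd h2, compProd_map_condDistrib hU]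
  have h3 : ∫⁻ ω, F (W ω, (U ω, V ω)) ∂P = ∫⁻ q, F (q.1.1, (q.1.2, q.2 + φ q.1))
      ∂(P.map fun ω => ((W ω, U ω), V ω - φ (W ω, U ω))) := by
    rw [lintegral_map' (by fun_prop) (hZ.prodMk hEm)]
    simp
  rw [h3, (indepFun_iff_map_prod_eq_prod_map_map hZ hEm).1 hind, hE,
    lintegral_prod _ (by fun_prop)]
  refine lintegral_congr fun z => ?_
  exact lintegral_cGaussian_add d (φ z) (G := fun x => F (z.1, (z.2, x))) (by fun_prop)

/-- The mean of the log-density is `-log d + E|V|² - E|E|² / d`, with `E` the residual, and the last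
two terms cancel as `1 - 1`. -/
theorem condMutualInfo_eq_of_residual (hU : AEMeasurable U P) (hV : AEMeasurable V P)
    (hW : AEMeasurable W P) (hVW : IndepFun W V P) (hV1 : P.map V = cGaussian 1)
    (hφ : Measurable φ) (hd : 0 < d)
    (hE : P.map (fun ω => V ω - φ (W ω, U ω)) = cGaussian d)
    (hind : IndepFun (fun ω => (W ω, U ω)) (fun ω => V ω - φ (W ω, U ω)) P)
    (hVi : Integrable (fun ω => ‖V ω‖ ^ 2) P) (hVs : ∫ ω, ‖V ω‖ ^ 2 ∂P = 1)
    (hEi : Integrable (fun ω => ‖V ω - φ (W ω, U ω)‖ ^ 2) P)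
    (hEs : ∫ ω, ‖V ω - φ (W ω, U ω)‖ ^ 2 ∂P = d) :
    condMutualInfo P U V W = ENNReal.ofReal (-Real.log d) ∧ 0 ≤ -Real.log d := by
  have hm : AEMeasurable (fun ω => (W ω, (U ω, V ω))) P := hW.prodMk (hU.prodMk hV)
  have := Measure.isProbabilityMeasure_map hm
  have := Measure.isProbabilityMeasure_map hW
  have hf : Measurable fun p : 𝓦 × 𝓤 × ℂ => gaussianRatio d (φ (p.1, p.2.1)) p.2.2 :=
    measurable_gaussianRatio d (by fun_prop) (by fun_prop)
  have hi' : Integrable (fun ω => -Real.log d + (‖V ω‖ ^ 2 -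
      ‖V ω - φ (W ω, U ω)‖ ^ 2 / d)) P :=
    (integrable_const _).add (hVi.sub (hEi.div_const d))
  have hmeas : AEStronglyMeasurable (fun p : 𝓦 × 𝓤 × ℂ =>
      Real.log (gaussianRatio d (φ (p.1, p.2.1)) p.2.2))
      (P.map (fun ω => (W ω, (U ω, V ω)))) := hf.log.aestronglyMeasurable
  have hval : ∫ p, Real.log (gaussianRatio d (φ (p.1, p.2.1)) p.2.2)
      ∂(P.map (fun ω => (W ω, (U ω, V ω)))) = -Real.log d := by
    rw [integral_map hm hmeas]
    simp_rw [log_gaussianRatio hd]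
    have h1 : Integrable (fun ω => ‖V ω - φ (W ω, U ω)‖ ^ 2 / d) P := hEi.div_const d
    have h2 : Integrable (fun ω => ‖V ω‖ ^ 2 - ‖V ω - φ (W ω, U ω)‖ ^ 2 / d) P := hVi.sub h1
    rw [integral_add (integrable_const _) h2, integral_sub hVi h1, hVs, integral_div, hEs,
      div_self hd.ne']
    simp
  have hkl := klDiv_withDensity_ofReal hf (fun _ => gaussianRatio_pos hd _ _)
    (map_eq_withDensity_compProd hU hV hW hVW hV1 hφ hd hE hind)
    ((integrable_map_measure hmeas hm).2 (hi'.congr (.of_forall fun ω => (log_gaussianRatio hd _ _).symm)))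
  rw [hval] at hkl
  exact hkl

end KL

/-! ### The averaged receiver function: closed form and divergence. -/

section ReceiverOutput

theorem re_star_dotProduct_self {ι : Type*} [Fintype ι] (u : ι → ℂ) :
    (star u ⬝ᵥ u).re = ∑ i, ‖u i‖ ^ 2 := by
  rw [dotProduct, Complex.re_sum]
  refine Finset.sum_congr rfl fun i _ => ?_
  rw [Pi.star_apply, ← Complex.normSq_eq_norm_sq, RCLike.star_def, ← Complex.normSq_eq_conj_mul_self,
    Complex.ofReal_re]

theorem re_star_dotProduct_comm {ι : Type*} [Fintype ι] (u v : ι → ℂ) :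
    (star u ⬝ᵥ v).re = (star v ⬝ᵥ u).re := by
  rw [Matrix.star_dotProduct, RCLike.star_def, Complex.conj_re]

theorem sum_norm_sub_sq {ι : Type*} [Fintype ι] (u v : ι → ℂ) :
    ∑ i, ‖(u - v) i‖ ^ 2 = ∑ i, ‖u i‖ ^ 2 + ∑ i, ‖v i‖ ^ 2 - 2 * (star u ⬝ᵥ v).re := by
  rw [← re_star_dotProduct_self, ← re_star_dotProduct_self, ← re_star_dotProduct_self, star_sub,
    sub_dotProduct, dotProduct_sub, dotProduct_sub]
  simp only [Complex.sub_re]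
  rw [re_star_dotProduct_comm v u]
  ring

variable {nT nR : ℕ}

/-- Completing the square in the exponent of a receiver function. -/
theorem receiver_exponent_factor (L : Matrix (Fin nT) (Fin nT) ℂ) (V : Matrix (Fin nT) (Fin nR) ℂ)
    (y : Fin nR → ℂ) (x : Fin nT → ℂ) :
    2 * (star x ⬝ᵥ ((Lᴴ * V) *ᵥ y)).re - (star x ⬝ᵥ ((Lᴴ * L - 1) *ᵥ x)).re =
      ∑ i, ‖(V *ᵥ y) i‖ ^ 2 + ∑ i, ‖x i‖ ^ 2 - ∑ i, ‖(L *ᵥ x - V *ᵥ y) i‖ ^ 2 := by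
  have h : ∀ w, star x ⬝ᵥ (Lᴴ *ᵥ w) = star (L *ᵥ x) ⬝ᵥ w := by
    intro w
    rw [Matrix.star_mulVec, Matrix.dotProduct_mulVec]
  rw [Matrix.sub_mulVec, Matrix.one_mulVec, ← Matrix.mulVec_mulVec, ← Matrix.mulVec_mulVec,
    dotProduct_sub, h, h, sum_norm_sub_sq, Complex.sub_re, re_star_dotProduct_self,
    re_star_dotProduct_self]
  ring

/-- The Jacobian is the determinant over `ℝ` of a complex-linear map, which is `|det L|²`. -/
theorem lintegral_comp_mulVec (L : Matrix (Fin nT) (Fin nT) ℂ) (hL : L.det ≠ 0)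
    {h : (Fin nT → ℂ) → ℝ≥0∞} (hh : Measurable h) :
    ∫⁻ x, h (L *ᵥ x) = ENNReal.ofReal (‖L.det‖ ^ 2)⁻¹ * ∫⁻ x, h x := by
  let f : (Fin nT → ℂ) →ₗ[ℝ] (Fin nT → ℂ) := (Matrix.toLin' L).restrictScalars ℝ
  have hdet : LinearMap.det f = ‖L.det‖ ^ 2 := by
    rw [LinearMap.det_restrictScalars, LinearMap.det_toLin', Algebra.norm_complex_apply,
      Complex.normSq_eq_norm_sq]
  have hf0 : LinearMap.det f ≠ 0 := by
    rw [hdet]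
    exact pow_ne_zero _ (norm_ne_zero_iff.2 hL)
  have hm : Measurable f := f.continuous_of_finiteDimensional.measurable
  have := Measure.map_linearMap_addHaar_eq_smul_addHaar (volume : Measure (Fin nT → ℂ)) hf0
  calc ∫⁻ x, h (L *ᵥ x) = ∫⁻ x, h x ∂(Measure.map f volume) := (lintegral_map hh hm).symm
    _ = _ := by
      rw [this, lintegral_smul_measure, hdet, abs_of_nonneg (by positivity), smul_eq_mul]

theorem lintegral_cscGaussian_one (n : ℕ) {G : (Fin n → ℂ) → ℝ≥0∞} (hG : Measurable G) :
    ∫⁻ x, G x ∂(cscGaussian n 1) =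
      ∫⁻ x, ENNReal.ofReal ((Real.pi ^ n)⁻¹ * Real.exp (-(∑ i, ‖x i‖ ^ 2))) * G x := by
  have hm : Measurable fun x : Fin n → ℂ => ENNReal.ofReal (((Real.pi * 1) ^ n)⁻¹ *
      Real.exp (-(∑ i, ‖x i‖ ^ 2) / 1)) := by fun_prop
  rw [cscGaussian, lintegral_withDensity_eq_lintegral_mul _ hm hG]
  simp only [mul_one, div_one, Pi.mul_apply]

theorem lintegral_standard_density (n : ℕ) :
    ∫⁻ x : Fin n → ℂ, ENNReal.ofReal ((Real.pi ^ n)⁻¹ * Real.exp (-(∑ i, ‖x i‖ ^ 2))) = 1 := by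
  have := isProbabilityMeasure_cscGaussian one_pos n
  have h := lintegral_cscGaussian_one n (G := fun _ => 1) measurable_const
  simpa using h.symm

theorem measurable_receiverFn (Hr : Matrix (Fin nT) (Fin nR) ℂ) (Gr : Matrix (Fin nT) (Fin nT) ℂ)
    (y : Fin nR → ℂ) : Measurable fun x => ENNReal.ofReal (receiverFn Hr Gr y x) := by
  apply Measurable.ennreal_ofReal
  apply Continuous.measurable
  unfold receiverFn
  simp only [dotProduct, Matrix.mulVec]
  fun_prop

/-- After completing the square, the factor `exp ‖x‖²` cancels the Gaussian density, and `u = L x`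
leaves a translated standard density of mass 1. -/
theorem receiverOut_factor (L : Matrix (Fin nT) (Fin nT) ℂ) (hL : L.det ≠ 0)
    (V : Matrix (Fin nT) (Fin nR) ℂ) (y : Fin nR → ℂ) :
    receiverOut (Lᴴ * V) (Lᴴ * L - 1) y =
      ENNReal.ofReal (Real.exp (∑ i, ‖(V *ᵥ y) i‖ ^ 2) * (‖L.det‖ ^ 2)⁻¹) := by
  let h : (Fin nT → ℂ) → ℝ≥0∞ := fun u =>
    ENNReal.ofReal ((Real.pi ^ nT)⁻¹ * Real.exp (-(∑ i, ‖(u - V *ᵥ y) i‖ ^ 2)))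
  have hh : Measurable h := by
    simp only [h, Pi.sub_apply]
    fun_prop
  have hpt : ∀ x : Fin nT → ℂ,
      ENNReal.ofReal ((Real.pi ^ nT)⁻¹ * Real.exp (-(∑ i, ‖x i‖ ^ 2))) *
        ENNReal.ofReal (receiverFn (Lᴴ * V) (Lᴴ * L - 1) y x) =
      ENNReal.ofReal (Real.exp (∑ i, ‖(V *ᵥ y) i‖ ^ 2)) * h (L *ᵥ x) := by
    intro x
    rw [receiverFn, receiver_exponent_factor, ← ENNReal.ofReal_mul (by positivity),
      ← ENNReal.ofReal_mul (by positivity), mul_left_comm, mul_assoc, ← Real.exp_add,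
      ← Real.exp_add]
    congr 3
    ring
  rw [receiverOut, lintegral_cscGaussian_one _ (measurable_receiverFn _ _ _)]
  simp_rw [hpt]
  rw [lintegral_const_mul' _ _ ENNReal.ofReal_ne_top, lintegral_comp_mulVec L hL hh]
  have h1 : ∫⁻ x, h x = 1 := by
    rw [← lintegral_standard_density nT]
    exact lintegral_sub_right_eq_self (μ := (volume : Measure (Fin nT → ℂ))) (fun u =>
      ENNReal.ofReal ((Real.pi ^ nT)⁻¹ * Real.exp (-(∑ i, ‖u i‖ ^ 2)))) (V *ᵥ y)
  rw [h1, mul_one, ← ENNReal.ofReal_mul (by positivity)]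

/-- A function that dominates `exp (g + ℓ m)`, with `g` even and `ℓ m` odd, at its translates by the
multiples `m • w` of a nonzero vector has infinite integral. -/
theorem lintegral_eq_top_of_translates {E : Type*} [NormedAddCommGroup E] [NormedSpace ℝ E]
    [MeasurableSpace E] [BorelSpace E] [FiniteDimensional ℝ E] {μ : Measure E}
    [μ.IsAddHaarMeasure] {f : E → ℝ≥0∞} {w : E} (hw : w ≠ 0)
    {g : E → ℝ} (hg : Measurable g) (hge : ∀ x, g (-x) = g x)
    {l : ℕ → E → ℝ} (hl : ∀ m, Measurable (l m)) (hlo : ∀ m x, l m (-x) = -l m x)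
    (h : ∀ m x, ENNReal.ofReal (Real.exp (g x + l m x)) ≤ f (x + (m : ℝ) • w)) :
    ∫⁻ x, f x ∂μ = ⊤ := by
  -- This radius makes the balls around the points `m • w` pairwise disjoint.
  set r := ‖w‖ / 3 with hr
  have hr0 : 0 < r := by positivity
  set c := ∫⁻ x in Metric.ball 0 r, ENNReal.ofReal (Real.exp (g x)) ∂μ with hc
  have hmg : Measurable fun x => ENNReal.ofReal (Real.exp (g x)) := by fun_prop
  have hc0 : c ≠ 0 := by
    rw [hc, Ne, lintegral_eq_zero_iff hmg]
    intro h0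
    have h1 : ∀ᵐ x ∂(μ.restrict (Metric.ball 0 r)), False := by
      filter_upwards [h0] with x hx
      have := Real.exp_pos (g x)
      simp at hx
      linarith
    have h2 : μ (Metric.ball 0 r) = 0 := by
      simpa using h1
    exact (Metric.measure_ball_pos μ (0 : E) hr0).ne' h2
  have hball : ∀ m : ℕ, c ≤ ∫⁻ x in Metric.ball ((m : ℝ) • w) r, f x ∂μ := by
    intro m
    set B := Metric.ball (0 : E) r with hB
    have hBm : MeasurableSet B := Metric.isOpen_ball.measurableSet
    have h1 : ∫⁻ x in Metric.ball ((m : ℝ) • w) r, f x ∂μ =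
        ∫⁻ x in B, f (x + (m : ℝ) • w) ∂μ := by
      rw [← lintegral_indicator hBm, ← lintegral_indicator Metric.isOpen_ball.measurableSet,
        ← lintegral_add_right_eq_self _ ((m : ℝ) • w)]
      refine lintegral_congr fun x => ?_
      simp [Set.indicator, hB, Metric.mem_ball, dist_eq_norm]
    have h2 : ∫⁻ x in B, ENNReal.ofReal (Real.exp (g x + l m x)) ∂μ =
        ∫⁻ x in B, ENNReal.ofReal (Real.exp (g x - l m x)) ∂μ := by
      rw [← lintegral_indicator hBm, ← lintegral_indicator hBm, ← lintegral_neg_eq_self]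
      refine lintegral_congr fun x => ?_
      simp [Set.indicator, hB, hge, hlo, sub_eq_add_neg]
    -- Averaging over `x` and `-x` removes the odd part, since `exp t + exp (-t) ≥ 2`. Each ball
    -- therefore contributes at least `c`, uniformly in `m`.
    have h3 : 2 * c ≤ 2 * ∫⁻ x in B, ENNReal.ofReal (Real.exp (g x + l m x)) ∂μ := by
      rw [two_mul (∫⁻ x in B, ENNReal.ofReal (Real.exp (g x + l m x)) ∂μ)]
      nth_rw 2 [h2]
      have hml := hl m
      rw [← lintegral_add_left (by fun_prop), hc, ← lintegral_const_mul _ hmg]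
      refine lintegral_mono fun x => ?_
      rw [← ENNReal.ofReal_add (by positivity) (by positivity),
        ← ENNReal.ofReal_ofNat 2, ← ENNReal.ofReal_mul (by positivity)]
      apply ENNReal.ofReal_le_ofReal
      rw [sub_eq_add_neg, Real.exp_add, Real.exp_add, ← mul_add, mul_comm]
      gcongr
      have := Real.add_one_le_exp (l m x)
      have := Real.add_one_le_exp (-l m x)
      linarith
    rw [h1]
    refine ((ENNReal.mul_le_mul_iff_right two_ne_zero ENNReal.ofNat_ne_top).1 h3).trans ?_
    exact lintegral_mono fun x => h m x
  have hdisj : Pairwise (Function.onFun Disjoint fun m : ℕ => Metric.ball ((m : ℝ) • w) r) := by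
    intro m k hmk
    apply Metric.ball_disjoint_ball
    rw [dist_eq_norm, ← sub_smul, norm_smul, hr]
    have h1 : (1 : ℝ) ≤ ‖(m : ℝ) - k‖ := by
      have : (m : ℤ) - k ≠ 0 := by omega
      have := Int.one_le_abs this
      rw [Real.norm_eq_abs]
      exact_mod_cast this
    have := norm_nonneg w
    nlinarith
  refine top_unique ?_
  calc ⊤ = ∑' _ : ℕ, c := (ENNReal.tsum_const_eq_top_of_ne_zero hc0).symm
    _ ≤ ∑' m : ℕ, ∫⁻ x in Metric.ball ((m : ℝ) • w) r, f x ∂μ := ENNReal.tsum_le_tsum hball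
    _ = ∫⁻ x in ⋃ m : ℕ, Metric.ball ((m : ℝ) • w) r, f x ∂μ :=
        (lintegral_iUnion (fun _ => Metric.isOpen_ball.measurableSet) hdisj f).symm
    _ ≤ _ := setLIntegral_le_lintegral _ _

-- Some direction `w ≠ 0` has `wᴴ (1 + Gr) w ≤ 0`; along it the exponent of the integrand does not
-- decay, apart from a term odd in `x`.
open scoped ComplexOrder in
theorem receiverOut_eq_top (Hr : Matrix (Fin nT) (Fin nR) ℂ) {Gr : Matrix (Fin nT) (Fin nT) ℂ}
    (hG : Gr.IsHermitian) (hpos : ¬ (1 + Gr).PosDef) (y : Fin nR → ℂ) :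
    receiverOut Hr Gr y = ⊤ := by
  have hF : (1 + Gr).IsHermitian := Matrix.isHermitian_one.add hG
  set F := 1 + Gr with hFdef
  set b := Hr *ᵥ y with hb
  have hsym : ∀ u v, (star u ⬝ᵥ (F *ᵥ v)).re = (star v ⬝ᵥ (F *ᵥ u)).re := by
    intro u v
    rw [re_star_dotProduct_comm, Matrix.star_mulVec, hF.eq, Matrix.dotProduct_mulVec]
  obtain ⟨w, hw, hqw, hbw⟩ : ∃ w, w ≠ 0 ∧ (star w ⬝ᵥ (F *ᵥ w)).re ≤ 0 ∧
      0 ≤ (star w ⬝ᵥ b).re := by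
    obtain ⟨w, hw, hqw⟩ : ∃ w, w ≠ 0 ∧ (star w ⬝ᵥ (F *ᵥ w)).re ≤ 0 := by
      by_contra! hcon
      refine hpos (Matrix.PosDef.of_dotProduct_mulVec_pos hF fun x hx => ?_)
      rw [Complex.pos_iff]
      refine ⟨hcon x hx, ?_⟩
      have := hF.im_star_dotProduct_mulVec_self x
      simpa using this.symm
    -- Replacing `w` by `-w` keeps the quadratic form and flips the sign of the linear term.
    rcases le_total 0 (star w ⬝ᵥ b).re with h | h
    · exact ⟨w, hw, hqw, h⟩
    · refine ⟨-w, neg_ne_zero.2 hw, ?_, ?_⟩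
      · simpa [Matrix.mulVec_neg] using hqw
      · simpa using h
  have hcont : ∀ M : Matrix (Fin nT) (Fin nT) ℂ,
      Measurable fun x : Fin nT → ℂ => (star x ⬝ᵥ (M *ᵥ x)).re := by
    intro M
    apply Continuous.measurable
    simp only [dotProduct, Matrix.mulVec]
    fun_prop
  have hlin : ∀ v : Fin nT → ℂ, Measurable fun x : Fin nT → ℂ => (star x ⬝ᵥ v).re := by
    intro v
    apply Continuous.measurable
    simp only [dotProduct]
    fun_prop
  rw [receiverOut, lintegral_cscGaussian_one _ (measurable_receiverFn _ _ _)]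
  have hpt : ∀ x : Fin nT → ℂ,
      ENNReal.ofReal ((Real.pi ^ nT)⁻¹ * Real.exp (-(∑ i, ‖x i‖ ^ 2))) *
        ENNReal.ofReal (receiverFn Hr Gr y x) = ENNReal.ofReal (Real.pi ^ nT)⁻¹ *
      ENNReal.ofReal (Real.exp (2 * (star x ⬝ᵥ b).re - (star x ⬝ᵥ (F *ᵥ x)).re)) := by
    intro x
    rw [receiverFn, ENNReal.ofReal_mul (by positivity), mul_assoc,
      ← ENNReal.ofReal_mul (by positivity), ← Real.exp_add, hFdef, Matrix.add_mulVec,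
      Matrix.one_mulVec, dotProduct_add, Complex.add_re, re_star_dotProduct_self]
    congr 3
    ring
  simp_rw [hpt]
  have hl1 := hlin b
  have hl2 := hlin (F *ᵥ w)
  have hq := hcont F
  rw [lintegral_const_mul' _ _ ENNReal.ofReal_ne_top,
    lintegral_eq_top_of_translates hw
      (g := fun x => -(star x ⬝ᵥ (F *ᵥ x)).re) (by fun_prop) (by simp [Matrix.mulVec_neg])
      (l := fun m x => 2 * (star x ⬝ᵥ b).re - 2 * m * (star x ⬝ᵥ (F *ᵥ w)).re)
      (by fun_prop) (fun m x => by simp; ring) ?_,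
    ENNReal.mul_top (by positivity)]
  intro m x
  apply ENNReal.ofReal_le_ofReal
  apply Real.exp_le_exp.2
  have e : star ((m : ℝ) • w) = (m : ℂ) • star w := by
    ext i; simp
  have e' : (m : ℝ) • w = (m : ℂ) • w := by
    ext i; simp
  rw [star_add, e, e', Matrix.mulVec_add, Matrix.mulVec_smul]
  simp only [add_dotProduct, dotProduct_add, smul_dotProduct, dotProduct_smul, smul_eq_mul,
    Complex.add_re, ← Complex.ofReal_natCast, Complex.re_ofReal_mul]
  rw [hsym w x]
  -- Beyond the even and odd parts, translation by `m w` adds `2 m Re wᴴ b` and `-m² wᴴ F w`, both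
  -- nonnegative.
  have h1 : 0 ≤ (m : ℝ) * (star w ⬝ᵥ b).re := by positivity
  have h2 : (m : ℝ) * ((m : ℝ) * (star w ⬝ᵥ (F *ᵥ w)).re) ≤ 0 := by
    rw [← mul_assoc]
    exact mul_nonpos_of_nonneg_of_nonpos (by positivity) hqw
  linarith

end ReceiverOutput

/-! ### The GMI of a factored receiver. -/

section Expectation

variable {Ω : Type*} [MeasurableSpace Ω] {P : Measure Ω}

theorem expectation_coe {g : Ω → ℝ} (hg : Integrable g P) :
    expectation P (fun ω => ((g ω : ℝ) : EReal)) = ((∫ ω, g ω ∂P : ℝ) : EReal) := by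
  have h1 : ∀ r : ℝ, ((r : ℝ) : EReal).toENNReal = ENNReal.ofReal r := fun r => by
    simp [EReal.toENNReal]
  have h2 : ∫⁻ ω, ENNReal.ofReal (g ω) ∂P ≠ ⊤ := hg.lintegral_lt_top.ne
  have h3 : ∫⁻ ω, ENNReal.ofReal (-g ω) ∂P ≠ ⊤ := hg.neg.lintegral_lt_top.ne
  rw [expectation]
  simp_rw [← EReal.coe_neg, h1]
  rw [integral_eq_lintegral_pos_part_sub_lintegral_neg_part hg, EReal.coe_sub,
    EReal.coe_ennreal_toReal h2, EReal.coe_ennreal_toReal h3]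

/-- In `EReal`, `⊥` absorbs every summand, so the second expectation plays no role. -/
theorem gmi_eq_bot [IsProbabilityMeasure P] {nT nR : ℕ} (X : Ω → Fin nT → ℂ) (Y : Ω → Fin nR → ℂ)
    {Hr : Matrix (Fin nT) (Fin nR) ℂ} {Gr : Matrix (Fin nT) (Fin nT) ℂ}
    (h : ∀ y, receiverOut Hr Gr y = ⊤) : gmi P X Y Hr Gr = ⊥ := by
  have : expectation P (fun ω => ENNReal.log (receiverOut Hr Gr (Y ω))) = ⊤ := by
    simp [expectation, h]
  rw [gmi, this, EReal.neg_top, EReal.bot_add]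

/-- The term `E‖V Y‖²` occurs in both expectations and cancels. -/
theorem gmi_factor [IsProbabilityMeasure P] {nT nR : ℕ} {X : Ω → Fin nT → ℂ}
    {Y : Ω → Fin nR → ℂ} (L : Matrix (Fin nT) (Fin nT) ℂ) (hL : L.det ≠ 0)
    (V : Matrix (Fin nT) (Fin nR) ℂ)
    (hX : Integrable (fun ω => ∑ i, ‖X ω i‖ ^ 2) P)
    (hY : Integrable (fun ω => ∑ i, ‖(V *ᵥ Y ω) i‖ ^ 2) P)
    (hE : Integrable (fun ω => ∑ i, ‖(L *ᵥ X ω - V *ᵥ Y ω) i‖ ^ 2) P) :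
    gmi P X Y (Lᴴ * V) (Lᴴ * L - 1) = ((Real.log (‖L.det‖ ^ 2) + ∫ ω, ∑ i, ‖X ω i‖ ^ 2 ∂P -
      ∫ ω, ∑ i, ‖(L *ᵥ X ω - V *ᵥ Y ω) i‖ ^ 2 ∂P : ℝ) : EReal) := by
  have hd : 0 < ‖L.det‖ ^ 2 := by positivity
  have h1 : ∀ ω, ENNReal.log (receiverOut (Lᴴ * V) (Lᴴ * L - 1) (Y ω)) =
      ((∑ i, ‖(V *ᵥ Y ω) i‖ ^ 2 - Real.log (‖L.det‖ ^ 2) : ℝ) : EReal) := by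
    intro ω
    rw [receiverOut_factor L hL, ENNReal.log_ofReal_of_pos (by positivity),
      Real.log_mul (Real.exp_ne_zero _) (by positivity), Real.log_exp, Real.log_inv,
      sub_eq_add_neg]
  have h2 : ∀ ω, Real.log (receiverFn (Lᴴ * V) (Lᴴ * L - 1) (Y ω) (X ω)) =
      ∑ i, ‖(V *ᵥ Y ω) i‖ ^ 2 + ∑ i, ‖X ω i‖ ^ 2 - ∑ i, ‖(L *ᵥ X ω - V *ᵥ Y ω) i‖ ^ 2 := by
    intro ω
    rw [receiverFn, Real.log_exp, receiver_exponent_factor]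
  have hYX : Integrable (fun ω => ∑ i, ‖(V *ᵥ Y ω) i‖ ^ 2 + ∑ i, ‖X ω i‖ ^ 2) P := hY.add hX
  rw [gmi]
  simp_rw [h1, h2]
  have hY' : Integrable (fun ω => ∑ i, ‖(V *ᵥ Y ω) i‖ ^ 2 - Real.log (‖L.det‖ ^ 2)) P :=
    hY.sub (integrable_const _)
  have hYXE : Integrable (fun ω => ∑ i, ‖(V *ᵥ Y ω) i‖ ^ 2 + ∑ i, ‖X ω i‖ ^ 2 -
      ∑ i, ‖(L *ᵥ X ω - V *ᵥ Y ω) i‖ ^ 2) P := hYX.sub hE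
  rw [expectation_coe hY', expectation_coe hYXE,
    integral_sub hY (integrable_const _), integral_sub hYX hE, integral_add hY hX]
  simp only [integral_const, probReal_univ, one_smul]
  rw [← EReal.coe_neg, ← EReal.coe_add]
  congr 1
  ring

end Expectation

/-! ### The channel variables as functionals of one standard Gaussian vector. -/

section Channel

variable {Ω : Type*}

theorem IsStdGaussian.condMutualInfo_eq [MeasurableSpace Ω] {P : Measure Ω}
    [IsProbabilityMeasure P] {ι : Type*} [Fintype ι] {S : Ω → EuclideanSpace ℂ ι}
    (hS : IsStdGaussian S P) {α β : Type*} [Fintype α] [Fintype β] {x : EuclideanSpace ℂ ι}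
    (hx : ‖x‖ = 1) {p : α → EuclideanSpace ℂ ι} (hp : ∀ l, inner ℂ (p l) x = 0)
    {y : β → EuclideanSpace ℂ ι} {a : α ⊕ β → ℂ}
    (ha : ∀ i, inner ℂ (Sum.elim p y i) (x - ∑ i, a i • Sum.elim p y i) = 0)
    (hne : x - ∑ i, a i • Sum.elim p y i ≠ 0) :
    condMutualInfo P (fun ω j => inner ℂ (y j) (S ω)) (fun ω => inner ℂ x (S ω))
      (fun ω l => inner ℂ (p l) (S ω)) =
        ENNReal.ofReal (-Real.log (‖x - ∑ i, a i • Sum.elim p y i‖ ^ 2)) ∧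
      0 ≤ -Real.log (‖x - ∑ i, a i • Sum.elim p y i‖ ^ 2) := by
  set r := x - ∑ i, a i • Sum.elim p y i with hr
  have hx0 : x ≠ 0 := by
    rintro rfl
    simp at hx
  -- The best linear predictor; its coefficients are conjugated because coefficient vectors occupy
  -- the conjugate-linear slot.
  let φ : (α → ℂ) × (β → ℂ) → ℂ := fun q =>
    ∑ l, (starRingEnd ℂ) (a (Sum.inl l)) * q.1 l + ∑ j, (starRingEnd ℂ) (a (Sum.inr j)) * q.2 j
  have hφ : Measurable φ := by fun_prop
  have hres : ∀ ω, inner ℂ x (S ω) - φ (fun l => inner ℂ (p l) (S ω),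
      fun j => inner ℂ (y j) (S ω)) = inner ℂ r (S ω) := by
    intro ω
    rw [hr, inner_sub_left, sum_inner, Fintype.sum_sum_type]
    simp only [inner_smul_left, Sum.elim_inl, Sum.elim_inr, φ]
  have hxn := hS.integrable_norm_inner_sq x
  have hrn := hS.integrable_norm_inner_sq r
  have hcomp : Measurable fun q : α ⊕ β → ℂ =>
      ((fun l => q (Sum.inl l), fun j => q (Sum.inr j)) : (α → ℂ) × (β → ℂ)) := by fun_prop
  refine condMutualInfo_eq_of_residual (φ := φ) (d := ‖r‖ ^ 2)
    (aemeasurable_pi_iff.2 fun j => hS.aemeasurable_inner (y j)) (hS.aemeasurable_inner x)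
    (aemeasurable_pi_iff.2 fun l => hS.aemeasurable_inner (p l))
    (hS.indepFun_inner x p hp).symm ?_ hφ (by positivity) ?_ ?_ hxn.1 ?_ ?_ ?_
  · rw [hS.map_inner hx0, hx, one_pow]
  · simp_rw [hres]
    exact hS.map_inner hne
  · simp_rw [hres]
    exact ((hS.indepFun_inner r _ ha).comp measurable_id hcomp).symm
  · rw [hxn.2, hx, one_pow]
  · simp_rw [hres]
    exact hrn.1
  · simp_rw [hres]
    exact hrn.2

variable {nT nR : ℕ}

/-- The input vector and the normalized noise vector, as one vector. -/
def sourceVector (N₀ : ℝ) (X : Ω → Fin nT → ℂ) (N : Ω → Fin nR → ℂ) :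
    Ω → EuclideanSpace ℂ (Fin nT ⊕ Fin nR) :=
  fun ω => WithLp.toLp 2 (Sum.elim (X ω) fun j => ((√N₀ : ℝ) : ℂ)⁻¹ * N ω j)

theorem inner_sourceVector (N₀ : ℝ) (X : Ω → Fin nT → ℂ) (N : Ω → Fin nR → ℂ)
    (c : EuclideanSpace ℂ (Fin nT ⊕ Fin nR)) (ω : Ω) :
    inner ℂ c (sourceVector N₀ X N ω) = ∑ i, (starRingEnd ℂ) (c (Sum.inl i)) * X ω i +
      ∑ j, (starRingEnd ℂ) (c (Sum.inr j)) * (((√N₀ : ℝ) : ℂ)⁻¹ * N ω j) := by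
  rw [PiLp.inner_apply, Fintype.sum_sum_type]
  simp [sourceVector, mul_comm]

theorem isStdGaussian_sourceVector [MeasurableSpace Ω] {P : Measure Ω} {N₀ : ℝ} (hN₀ : 0 < N₀) {X : Ω → Fin nT → ℂ}
    {N : Ω → Fin nR → ℂ} (hX : HasLaw X (cscGaussian nT 1) P)
    (hN : HasLaw N (cscGaussian nR N₀) P) (hXN : IndepFun X N P) :
    IsStdGaussian (sourceVector N₀ X N) P := by
  have hXm := hX.aemeasurable
  have hNm := hN.aemeasurable
  refine ⟨?_, fun c => ?_⟩
  · have : Measurable fun q : (Fin nT → ℂ) × (Fin nR → ℂ) =>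
        (WithLp.toLp 2 (Sum.elim q.1 fun j => ((√N₀ : ℝ) : ℂ)⁻¹ * q.2 j) :
          EuclideanSpace ℂ (Fin nT ⊕ Fin nR)) := by
      apply (WithLp.measurable_toLp 2 _).comp
      rw [measurable_pi_iff]
      rintro (i | j)
      · simp only [Sum.elim_inl]; fun_prop
      · simp only [Sum.elim_inr]; fun_prop
    exact this.comp_aemeasurable (hXm.prodMk hNm)
  · have hs : 0 < √N₀ := Real.sqrt_pos.2 hN₀
    let f : (Fin nT → ℂ) → ℂ := fun x =>
      Complex.exp ((∑ i, inner ℝ (c (Sum.inl i)) (x i) : ℝ) * Complex.I)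
    let g : (Fin nR → ℂ) → ℂ := fun x =>
      Complex.exp ((∑ j, inner ℝ (((√N₀ : ℝ) : ℂ)⁻¹ * c (Sum.inr j)) (x j) : ℝ) * Complex.I)
    have hf : Continuous f := by fun_prop
    have hg : Continuous g := by fun_prop
    have h1 : ∀ ω, Complex.exp ((inner ℂ c (sourceVector N₀ X N ω)).re * Complex.I) =
        f (X ω) * g (N ω) := by
      intro ω
      rw [inner_sourceVector, ← Complex.exp_add, ← add_mul, ← Complex.ofReal_add, Complex.add_re,
        Complex.re_sum, Complex.re_sum]
      simp only [Complex.inner, map_mul, map_inv₀, Complex.conj_ofReal]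
      congr 4
      · simp_rw [mul_comm]
      · refine Finset.sum_congr rfl fun j _ => ?_
        congr 1
        ring
    simp_rw [h1]
    have hind : IndepFun (f ∘ X) (g ∘ N) P := hXN.comp hf.measurable hg.measurable
    have h2 := hind.integral_fun_mul_eq_mul_integral
      (hf.measurable.comp_aemeasurable hXm).aestronglyMeasurable
      (hg.measurable.comp_aemeasurable hNm).aestronglyMeasurable
    simp only [Function.comp_apply] at h2
    have h3 : ∫ ω, f (X ω) ∂P = ∫ x, f x ∂(cscGaussian nT 1) := by
      rw [← hX.map_eq, integral_map hXm (by fun_prop)]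
    have h4 : ∫ ω, g (N ω) ∂P = ∫ x, g x ∂(cscGaussian nR N₀) := by
      rw [← hN.map_eq, integral_map hNm (by fun_prop)]
    rw [h2, h3, h4, integral_cexp_cscGaussian one_pos, integral_cexp_cscGaussian hN₀,
      ← Complex.exp_add, ← Complex.ofReal_neg, ← Complex.ofReal_neg, ← Complex.ofReal_neg,
      ← Complex.ofReal_add, EuclideanSpace.norm_sq_eq, Fintype.sum_sum_type]
    congr 2
    simp_rw [norm_mul, norm_inv, Complex.norm_real, Real.norm_eq_abs, abs_of_pos hs, mul_pow,
      inv_pow, Real.sq_sqrt hN₀.le]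
    rw [← Finset.mul_sum]
    field_simp
    ring

/-- The coefficient vector of the input symbol `X i`. -/
def inputVector (nR : ℕ) (i : Fin nT) : EuclideanSpace ℂ (Fin nT ⊕ Fin nR) :=
  EuclideanSpace.single (Sum.inl i) 1

/-- The coefficient vector of the output symbol `Y j`. -/
def outputVector (H : Matrix (Fin nR) (Fin nT) ℂ) (N₀ : ℝ) (j : Fin nR) :
    EuclideanSpace ℂ (Fin nT ⊕ Fin nR) :=
  WithLp.toLp 2 (Sum.elim (fun i => (starRingEnd ℂ) (H j i))
    fun l => if l = j then ((√N₀ : ℝ) : ℂ) else 0)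

theorem inner_inputVector (N₀ : ℝ) (X : Ω → Fin nT → ℂ) (N : Ω → Fin nR → ℂ) (i : Fin nT)
    (ω : Ω) : inner ℂ (inputVector nR i) (sourceVector N₀ X N ω) = X ω i := by
  simp [inputVector, sourceVector, EuclideanSpace.inner_single_left]

theorem inner_outputVector {N₀ : ℝ} (hN₀ : 0 < N₀) (H : Matrix (Fin nR) (Fin nT) ℂ)
    (X : Ω → Fin nT → ℂ) (N : Ω → Fin nR → ℂ) (j : Fin nR) (ω : Ω) :
    inner ℂ (outputVector H N₀ j) (sourceVector N₀ X N ω) = (H *ᵥ X ω + N ω) j := by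
  have hs : ((√N₀ : ℝ) : ℂ) ≠ 0 := by exact_mod_cast (Real.sqrt_pos.2 hN₀).ne'
  rw [inner_sourceVector]
  simp [outputVector, Matrix.mulVec, dotProduct, apply_ite, hs]

/-- The indices of the symbols preceding the `k`-th one within memory `K`. -/
abbrev PastIndex (K : ℕ) (k : Fin nT) : Type :=
  {j : Fin nT // (j : ℕ) < (k : ℕ) ∧ (k : ℕ) ≤ (j : ℕ) + K}

/-- The coefficient vectors of the symbols preceding `X k` and of the channel output. -/
def observationVectors (K : ℕ) (H : Matrix (Fin nR) (Fin nT) ℂ) (N₀ : ℝ) (k : Fin nT) :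
    PastIndex K k ⊕ Fin nR → EuclideanSpace ℂ (Fin nT ⊕ Fin nR) :=
  Sum.elim (fun l => inputVector nR l.1) (outputVector H N₀)

/-- The prediction error is never zero: a noise coordinate of the combination vanishes only if the
corresponding output is not used, and the past symbols have no component along `X_k`. -/
theorem inputVector_sub_sum_ne_zero (K : ℕ) (H : Matrix (Fin nR) (Fin nT) ℂ) {N₀ : ℝ}
    (hN₀ : 0 < N₀) (k : Fin nT) (a : PastIndex K k ⊕ Fin nR → ℂ) :
    inputVector nR k - ∑ i, a i • observationVectors K H N₀ k i ≠ 0 := by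
  have hs : ((√N₀ : ℝ) : ℂ) ≠ 0 := by exact_mod_cast (Real.sqrt_pos.2 hN₀).ne'
  intro h
  have hc : ∀ t, (inputVector nR k - ∑ i, a i • observationVectors K H N₀ k i).ofLp t = 0 := by
    intro t
    rw [h]
    rfl
  have ha : ∀ j, a (Sum.inr j) = 0 := by
    intro j
    have := hc (Sum.inr j)
    simpa [Fintype.sum_sum_type, observationVectors, inputVector, outputVector, hs] using this
  have h1 := hc (Sum.inl k)
  have h2 : ∀ l : PastIndex K k, (inputVector nR l.1).ofLp (Sum.inl k) = 0 := by
    intro l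
    have : k ≠ l.1 := by
      intro h
      have := l.2.1
      rw [← h] at this
      exact lt_irrefl _ this
    simp [inputVector, this]
  simp [Fintype.sum_sum_type, observationVectors, ha, h2] at h1
  simp [inputVector] at h1

theorem sum_eq_add_sum_past {M : Type*} [AddCommMonoid M] {K : ℕ} {k : Fin nT} {g : Fin nT → M}
    (hg : ∀ l, l ≠ k → ¬ ((l : ℕ) < k ∧ (k : ℕ) ≤ l + K) → g l = 0) :
    ∑ l, g l = g k + ∑ l : PastIndex K k, g l.1 := by
  have hk : k ∉ Finset.univ.filter fun l : Fin nT => (l : ℕ) < k ∧ (k : ℕ) ≤ l + K := by simp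
  rw [← Finset.sum_subtype (Finset.univ.filter fun l : Fin nT => (l : ℕ) < k ∧ (k : ℕ) ≤ l + K)
    (by simp) g, ← Finset.sum_insert hk]
  symm
  apply Finset.sum_subset (Finset.subset_univ _)
  intro l _ hl
  rw [Finset.mem_insert, not_or] at hl
  exact hg l hl.1 (by simpa using hl.2)

end Channel

/-! ### Row-by-row form of the GMI over factored receivers. -/

section Optimization

variable {Ω : Type*} {nT nR : ℕ}

/-- The coefficient vector of the `k`-th entry of `L X - V Y`. -/
def errorVector (H : Matrix (Fin nR) (Fin nT) ℂ) (N₀ : ℝ) (L : Matrix (Fin nT) (Fin nT) ℂ)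
    (V : Matrix (Fin nT) (Fin nR) ℂ) (k : Fin nT) : EuclideanSpace ℂ (Fin nT ⊕ Fin nR) :=
  ∑ l, (starRingEnd ℂ) (L k l) • inputVector nR l -
    ∑ j, (starRingEnd ℂ) (V k j) • outputVector H N₀ j

theorem inner_errorVector {N₀ : ℝ} (hN₀ : 0 < N₀) (H : Matrix (Fin nR) (Fin nT) ℂ)
    (L : Matrix (Fin nT) (Fin nT) ℂ) (V : Matrix (Fin nT) (Fin nR) ℂ)
    (X : Ω → Fin nT → ℂ) (N : Ω → Fin nR → ℂ) (k : Fin nT) (ω : Ω) :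
    inner ℂ (errorVector H N₀ L V k) (sourceVector N₀ X N ω) =
      (L *ᵥ X ω - V *ᵥ (H *ᵥ X ω + N ω)) k := by
  rw [errorVector, inner_sub_left, sum_inner, sum_inner]
  simp only [inner_smul_left, inner_inputVector, inner_outputVector hN₀, Complex.conj_conj,
    Pi.sub_apply, Matrix.mulVec, dotProduct]

/-- This is where the memory constraint becomes a restriction of row `k` to the `K` preceding
symbols. -/
theorem errorVector_of_isLowerBanded (H : Matrix (Fin nR) (Fin nT) ℂ) (N₀ : ℝ) {K : ℕ}
    {L : Matrix (Fin nT) (Fin nT) ℂ} (hL : IsLowerBanded K L) (V : Matrix (Fin nT) (Fin nR) ℂ)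
    (k : Fin nT) :
    errorVector H N₀ L V k = (starRingEnd ℂ) (L k k) • inputVector nR k -
      ∑ i, Sum.elim (fun l : PastIndex K k => -(starRingEnd ℂ) (L k l.1))
        (fun j => (starRingEnd ℂ) (V k j)) i • observationVectors K H N₀ k i := by
  rw [errorVector, sum_eq_add_sum_past (K := K) (k := k), Fintype.sum_sum_type]
  · simp only [observationVectors, Sum.elim_inl, Sum.elim_inr, neg_smul, Finset.sum_neg_distrib]
    abel
  · intro l hl h
    have : L k l = 0 := by
      by_contra h0
      have h1 := hL k l h0
      have h2 : (l : ℕ) ≠ k := fun h => hl (Fin.ext h)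
      omega
    simp [this]

variable [MeasurableSpace Ω] {P : Measure Ω} [IsProbabilityMeasure P]

theorem gmi_eq_sum_errorVector {H : Matrix (Fin nR) (Fin nT) ℂ} {N₀ : ℝ} (hN₀ : 0 < N₀)
    {X : Ω → Fin nT → ℂ} {N Y : Ω → Fin nR → ℂ} (hS : IsStdGaussian (sourceVector N₀ X N) P)
    (hY : ∀ ω, Y ω = H *ᵥ X ω + N ω) {K : ℕ} {L : Matrix (Fin nT) (Fin nT) ℂ}
    (hL : IsLowerBanded K L) (hd : ∀ k, L k k ≠ 0) (V : Matrix (Fin nT) (Fin nR) ℂ) :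
    gmi P X Y (Lᴴ * V) (Lᴴ * L - 1) =
      ((∑ k, (Real.log (‖L k k‖ ^ 2) + 1 - ‖errorVector H N₀ L V k‖ ^ 2) : ℝ) : EReal) := by
  have hdet : L.det ≠ 0 := by
    rw [hL.det]
    exact Finset.prod_ne_zero_iff.2 fun k _ => hd k
  have e1 : ∀ ω i, ‖X ω i‖ ^ 2 = ‖inner ℂ (inputVector nR i) (sourceVector N₀ X N ω)‖ ^ 2 :=
    fun ω i => by rw [inner_inputVector]
  have e2 : ∀ ω i, ‖(L *ᵥ X ω - V *ᵥ Y ω) i‖ ^ 2 =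
      ‖inner ℂ (errorVector H N₀ L V i) (sourceVector N₀ X N ω)‖ ^ 2 :=
    fun ω i => by rw [inner_errorVector hN₀, hY]
  have e3 : ∀ ω i, ‖(V *ᵥ Y ω) i‖ ^ 2 =
      ‖inner ℂ (errorVector H N₀ 0 (-V) i) (sourceVector N₀ X N ω)‖ ^ 2 :=
    fun ω i => by
      rw [inner_errorVector hN₀, hY, Matrix.zero_mulVec, Matrix.neg_mulVec, zero_sub, neg_neg]
  have hi : ∀ c : Fin nT → EuclideanSpace ℂ (Fin nT ⊕ Fin nR),
      Integrable (fun ω => ∑ i, ‖inner ℂ (c i) (sourceVector N₀ X N ω)‖ ^ 2) P :=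
    fun c => integrable_finsetSum _ fun i _ => (hS.integrable_norm_inner_sq (c i)).1
  have hint : ∀ c : Fin nT → EuclideanSpace ℂ (Fin nT ⊕ Fin nR),
      ∫ ω, ∑ i, ‖inner ℂ (c i) (sourceVector N₀ X N ω)‖ ^ 2 ∂P = ∑ i, ‖c i‖ ^ 2 := by
    intro c
    rw [integral_finsetSum _ fun i _ => (hS.integrable_norm_inner_sq (c i)).1]
    exact Finset.sum_congr rfl fun i _ => (hS.integrable_norm_inner_sq (c i)).2
  rw [gmi_factor L hdet V (by simp_rw [e1]; exact hi _) (by simp_rw [e3]; exact hi _)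
    (by simp_rw [e2]; exact hi _)]
  simp_rw [e1, e2]
  rw [hint, hint, hL.det, norm_prod, ← Finset.prod_pow,
    Real.log_prod (fun k _ => pow_ne_zero _ (norm_ne_zero_iff.2 (hd k))),
    Finset.sum_sub_distrib, Finset.sum_add_distrib]
  simp [inputVector]

open scoped ComplexOrder in
/-- Every admissible receiver with finite averages comes from a banded triangular matrix. -/
theorem exists_factor_of_isAdmissible {K : ℕ} (Hr : Matrix (Fin nT) (Fin nR) ℂ)
    {Gr : Matrix (Fin nT) (Fin nT) ℂ} (hG : IsAdmissible K Gr) (hpos : (1 + Gr).PosDef) :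
    ∃ (L : Matrix (Fin nT) (Fin nT) ℂ) (V : Matrix (Fin nT) (Fin nR) ℂ),
      IsLowerBanded K L ∧ (∀ k, L k k ≠ 0) ∧ Hr = Lᴴ * V ∧ Gr = Lᴴ * L - 1 := by
  obtain ⟨L, hLF, hL, hd⟩ := exists_banded_cholesky K hpos (by
    intro i j hij
    have hne : i ≠ j := by
      rintro rfl
      simp at hij
      omega
    rw [Matrix.add_apply, Matrix.one_apply_ne hne, zero_add, hG.2 i j hij])
  have hdet : IsUnit Lᴴ.det := by
    rw [Matrix.det_conjTranspose, hL.det, isUnit_iff_ne_zero, star_ne_zero]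
    exact Finset.prod_ne_zero_iff.2 fun k _ => hd k
  -- As `Lᴴ` is invertible, an arbitrary `Hr` corresponds to an arbitrary `V`.
  exact ⟨L, Lᴴ⁻¹ * Hr, hL, hd, (Matrix.mul_nonsing_inv_cancel_left _ _ hdet).symm, by
    rw [hLF, add_sub_cancel_left]⟩

end Optimization

end ChannelShortening

end

/-! ### Upper bound, attainment and value of the maximum. -/

theorem corollary3 {Ω : Type*} [MeasurableSpace Ω] (P : Measure Ω) [IsProbabilityMeasure P]
    (nT nR K : ℕ) (H : Matrix (Fin nR) (Fin nT) ℂ) (N₀ : ℝ) (hN₀ : 0 < N₀)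
    (X : Ω → Fin nT → ℂ) (N : Ω → Fin nR → ℂ) (Y : Ω → Fin nR → ℂ)
    (hX : HasLaw X (ChannelShortening.cscGaussian nT 1) P)
    (hN : HasLaw N (ChannelShortening.cscGaussian nR N₀) P)
    (hXN : IndepFun X N P)
    (hY : ∀ ω, Y ω = H *ᵥ X ω + N ω) :
    (∃ (Hr : Matrix (Fin nT) (Fin nR) ℂ) (Gr : Matrix (Fin nT) (Fin nT) ℂ),
      ChannelShortening.IsOptimal P X Y K Hr Gr) ∧
    ∀ (Hr : Matrix (Fin nT) (Fin nR) ℂ) (Gr : Matrix (Fin nT) (Fin nT) ℂ),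
      ChannelShortening.IsOptimal P X Y K Hr Gr →
        ChannelShortening.gmi P X Y Hr Gr =
          ((∑ k : Fin nT, ChannelShortening.condMutualInfo P Y (fun ω => X ω k)
            (ChannelShortening.pastSymbols X K k) : ℝ≥0∞) : EReal) := by
  open ChannelShortening in
  have hS := isStdGaussian_sourceVector hN₀ hX hN hXN
  choose a ha using fun k : Fin nT =>
    exists_residual (inputVector nR k) (observationVectors K H N₀ k)
  set r : Fin nT → EuclideanSpace ℂ (Fin nT ⊕ Fin nR) := fun k =>
    inputVector nR k - ∑ i, a k i • observationVectors K H N₀ k i with hr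
  have hr0 : ∀ k, r k ≠ 0 := fun k => inputVector_sub_sum_ne_zero K H hN₀ k (a k)
  have hrpos : ∀ k, 0 < ‖r k‖ := fun k => norm_pos_iff.2 (hr0 k)
  have hinfo : ∀ k, condMutualInfo P Y (fun ω => X ω k) (pastSymbols X K k) =
      ENNReal.ofReal (-Real.log (‖r k‖ ^ 2)) ∧ 0 ≤ -Real.log (‖r k‖ ^ 2) := by
    intro k
    have h := hS.condMutualInfo_eq (x := inputVector nR k) (by simp [inputVector])
      (p := fun l : PastIndex K k => inputVector nR l.1)
      (by
        intro l
        have : (l : Fin nT) ≠ k := fun h => by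
          have := l.2.1
          rw [h] at this
          exact lt_irrefl _ this
        simp [inputVector, EuclideanSpace.inner_single_left, this])
      (y := outputVector H N₀) (a := a k) (ha k) (hr0 k)
    simp_rw [inner_inputVector, inner_outputVector hN₀] at h
    have hY' : Y = fun ω j => (H *ᵥ X ω + N ω) j := funext hY
    rw [hY']
    exact h
  have hvalue : ((∑ k : Fin nT, condMutualInfo P Y (fun ω => X ω k) (pastSymbols X K k) : ℝ≥0∞) :
      EReal) = ((∑ k, -Real.log (‖r k‖ ^ 2) : ℝ) : EReal) := by
    rw [Finset.sum_congr rfl fun k _ => (hinfo k).1,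
      ← ENNReal.ofReal_sum_of_nonneg fun k _ => (hinfo k).2,
      EReal.coe_ennreal_ofReal, max_eq_left (Finset.sum_nonneg fun k _ => (hinfo k).2)]
  have hupper : ∀ (Hr : Matrix (Fin nT) (Fin nR) ℂ) (Gr : Matrix (Fin nT) (Fin nT) ℂ),
      IsAdmissible K Gr → gmi P X Y Hr Gr ≤ ((∑ k, -Real.log (‖r k‖ ^ 2) : ℝ) : EReal) := by
    intro Hr Gr hG
    open scoped ComplexOrder in
    by_cases hpos : (1 + Gr).PosDef
    · obtain ⟨L, V, hL, hd, rfl, rfl⟩ := exists_factor_of_isAdmissible Hr hG hpos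
      rw [gmi_eq_sum_errorVector hN₀ hS hY hL hd, EReal.coe_le_coe_iff]
      refine Finset.sum_le_sum fun k _ => ?_
      have hc : (starRingEnd ℂ) (L k k) ≠ 0 := by simpa using hd k
      have h1 : ‖L k k‖ * ‖r k‖ ≤ ‖errorVector H N₀ L V k‖ := by
        rw [errorVector_of_isLowerBanded H N₀ hL V k, ← RCLike.norm_conj (L k k)]
        exact norm_mul_norm_residual_le (ha k) hc _
      have h4 : (‖L k k‖ * ‖r k‖) ^ 2 ≤ ‖errorVector H N₀ L V k‖ ^ 2 := by gcongr
      have hLk : 0 < ‖L k k‖ := norm_pos_iff.2 (hd k)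
      -- The only other loss in the bound; it vanishes exactly when `|L k k| ‖r k‖ = 1`.
      have h5 := Real.log_le_sub_one_of_pos (x := ‖L k k‖ ^ 2 * ‖r k‖ ^ 2)
        (mul_pos (pow_pos hLk 2) (pow_pos (hrpos k) 2))
      rw [Real.log_mul (pow_pos hLk 2).ne' (pow_pos (hrpos k) 2).ne', ← mul_pow] at h5
      linarith
    · rw [gmi_eq_bot X Y (receiverOut_eq_top Hr hG.1 hpos)]
      exact bot_le
  have hattained : ∃ (Hr : Matrix (Fin nT) (Fin nR) ℂ) (Gr : Matrix (Fin nT) (Fin nT) ℂ),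
      IsAdmissible K Gr ∧
        gmi P X Y Hr Gr = ((∑ k, -Real.log (‖r k‖ ^ 2) : ℝ) : EReal) := by
    -- Row `k` of `L` and `V` is chosen so that the error vector is `r k / ‖r k‖`, which makes both
    -- inequalities of the upper bound equalities.
    let L : Matrix (Fin nT) (Fin nT) ℂ := Matrix.of fun k l =>
      ((‖r k‖⁻¹ : ℝ) : ℂ) * if l = k then 1 else
        if h : (l : ℕ) < (k : ℕ) ∧ (k : ℕ) ≤ (l : ℕ) + K then
          -(starRingEnd ℂ) (a k (Sum.inl ⟨l, h⟩)) else 0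
    let V : Matrix (Fin nT) (Fin nR) ℂ := Matrix.of fun k j =>
      ((‖r k‖⁻¹ : ℝ) : ℂ) * (starRingEnd ℂ) (a k (Sum.inr j))
    have hLk : ∀ k, L k k = ((‖r k‖⁻¹ : ℝ) : ℂ) := fun k => by
      simp only [L, Matrix.of_apply, if_true, mul_one]
    have hLp : ∀ k (l : PastIndex K k), L k l.1 =
        ((‖r k‖⁻¹ : ℝ) : ℂ) * -(starRingEnd ℂ) (a k (Sum.inl l)) := by
      intro k l
      have : l.1 ≠ k := fun h => by
        have := l.2.1
        rw [h] at this
        exact lt_irrefl _ this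
      simp only [L, Matrix.of_apply]
      rw [if_neg this, dif_pos l.2]
    have hd : ∀ k, L k k ≠ 0 := by
      intro k
      rw [hLk]
      exact_mod_cast (inv_pos.2 (hrpos k)).ne'
    have hL : IsLowerBanded K L := by
      intro k l h
      by_cases h1 : l = k
      · subst h1; omega
      · by_cases h2 : (l : ℕ) < (k : ℕ) ∧ (k : ℕ) ≤ (l : ℕ) + K
        · exact ⟨h2.1.le, h2.2⟩
        · refine absurd ?_ h
          simp only [L, Matrix.of_apply]
          rw [if_neg h1, dif_neg h2, mul_zero]
    refine ⟨Lᴴ * V, Lᴴ * L - 1, hL.isAdmissible, ?_⟩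
    rw [gmi_eq_sum_errorVector hN₀ hS hY hL hd]
    congr 1
    refine Finset.sum_congr rfl fun k _ => ?_
    have he : errorVector H N₀ L V k = ((‖r k‖⁻¹ : ℝ) : ℂ) • r k := by
      change errorVector H N₀ L V k = ((‖r k‖⁻¹ : ℝ) : ℂ) •
        (inputVector nR k - ∑ i, a k i • observationVectors K H N₀ k i)
      rw [errorVector_of_isLowerBanded H N₀ hL V k, smul_sub, hLk, Complex.conj_ofReal,
        Finset.smul_sum]
      congr 1
      refine Finset.sum_congr rfl fun i _ => ?_
      rw [smul_smul]
      congr 1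
      rcases i with l | j
      · rw [Sum.elim_inl, hLp, map_mul, Complex.conj_ofReal, map_neg, Complex.conj_conj, mul_neg,
          neg_neg]
      · simp only [Sum.elim_inr, V, Matrix.of_apply, map_mul, Complex.conj_ofReal,
          Complex.conj_conj]
    have hn : ‖errorVector H N₀ L V k‖ = 1 := by
      rw [he, norm_smul, Complex.norm_real, norm_inv, norm_norm, inv_mul_cancel₀ (hrpos k).ne']
    rw [hn, hLk, Complex.norm_real, norm_inv, norm_norm, inv_pow, Real.log_inv]
    ring
  rw [hvalue]
  obtain ⟨Hr₀, Gr₀, hG₀, hval₀⟩ := hattained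
  refine ⟨⟨Hr₀, Gr₀, hG₀, fun Hr Gr hG => hval₀ ▸ hupper Hr Gr hG⟩, fun Hr Gr hopt => ?_⟩
  exact le_antisymm (hupper Hr Gr hopt.1) (hval₀ ▸ hopt.2 Hr₀ Gr₀ hG₀)
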